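/- Let $\Bbbk$ be a field, $S=\Bbbk[x_1,\dots,x_n]$ with its standard grading, and let the symmetric group $\mathfrak S_n$ act on $S$ by permuting the variables. For $\mathbf a\in\mathbb Z_{\ge 0}^n$ write $x^{\mathbf a}=x_1^{a_1}\cdots x_n^{a_n}$ and $|\mathbf a|=a_1+\cdots+a_n$. A partition of length $n$ is a sequence $\lambda=(\lambda_1,\dots,\lambda_n)$ of integers with $0\le\lambda_1\le\cdots\le\lambda_n$. For a monomial ideal $I\subset S$ that is $\mathfrak S_n$-fixed (that is, $\sigma(I)=I$ for all $\sigma\in\mathfrak S_n$), let $P(I)$ be the set of partitions $\lambda$ of length $n$ with $x^\lambda\in I$, and let $\Lambda(I)$ be the set of those $\lambda\in P(I)$ for which $x^\lambda$ is a minimal monomial generator of $I$. The ideal $I$ is a symmetric shifted ideal if it is an $\mathfrak S_n$-fixed monomial ideal and, for every $\lambda\in P(I)$ and $1\le k<n$ with $\lambda_k<\lambda_n$, one has $x^\lambda(x_k/x_n)\in I$. For a partition $\lambda$ of length $n$ put $p(\lambda)=\#\{k:\lambda_k<\lambda_n-1\}$, $r(\lambda)=\#\{k:\lambda_k=\lambda_n\}$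 and $\lambda_{\le p}=(\lambda_1,\dots,\lambda_p)$. For a finite sequence $c$ of nonnegative integers let $\operatorname{type}(c)!=\prod_{v\ge 0}t_v!$, where $t_v$ is the number of entries of $c$ equal to $v$. Let $\beta_{i,j}(I)=\dim_\Bbbk\operatorname{Tor}^S_i(I,\Bbbk)_j$ be the graded Betti numbers of $I$. If $I\subset S$ is a symmetric shifted ideal, then for all integers $i,d\ge 0$ $$\beta_{i,i+d}(I)=\sum_{\lambda\in\Lambda(I),\ |\lambda|=d}\left(\sum_{k+l=i}\frac{p(\lambda)!}{\operatorname{type}(\lambda_{\le p(\lambda)})!}\binom{n}{p(\lambda)}\binom{n-p(\lambda)}{r(\lambda)+k}\binom{r(\lambda)+k-1}{k}\binom{p(\lambda)}{l}\right),$$ where the inner sum is over integers $k,l\ge 0$ with $k+l=i$. -/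

import Mathlib

open MvPolynomial

namespace SymShifted

universe u v

/-! ### Graded free resolutions and graded Betti numbers -/

section Resolutions

variable {n : ℕ} {K : Type u} [Field K]

/-- An element `x` of the graded free module `⨁_b S(-deg b)` (with `S = K[x_1, …, x_n]` in its
standard grading) is homogeneous of degree `j`: each coordinate `x b` only involves monomials of
degree `j - deg b`. -/
def HomogeneousOfDegree {B : Type v} (deg : B → ℤ) (x : B →₀ MvPolynomial (Fin n) K) (j : ℤ) :
    Prop :=
  ∀ b, ∀ m ∈ (x b).support, (m.degree : ℤ) + deg b = j

/-- The subquotient `Z / (W ∩ Z)` of `V`; this is `Z / W` when `W ≤ Z`. -/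
abbrev Subquotient {V : Type*} [AddCommGroup V] [Module K V] (Z W : Submodule K V) : Type _ :=
  Z ⧸ W.submoduleOf Z

/-- A graded free resolution `⋯ → F_2 → F_1 → F_0 → I → 0` of an ideal `I` of
`S = K[x_1, …, x_n]`, where `F_i = ⨁_{b : basis i} S(-deg i b)` and all the maps are homogeneous
of degree `0`. The modules may have infinite rank and the resolution need not be minimal. -/
structure GradedFreeResolution (I : Ideal (MvPolynomial (Fin n) K)) where
  /-- the basis of `F_i` -/
  basis : ℕ → Type v
  /-- the degrees of the basis elements of `F_i` -/
  deg : ∀ i, basis i → ℤ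
  /-- the differential `F_{i+1} → F_i` -/
  d : ∀ i, (basis (i + 1) →₀ MvPolynomial (Fin n) K) →ₗ[MvPolynomial (Fin n) K]
    (basis i →₀ MvPolynomial (Fin n) K)
  /-- the augmentation `F_0 → I` -/
  aug : (basis 0 →₀ MvPolynomial (Fin n) K) →ₗ[MvPolynomial (Fin n) K] I
  d_homogeneous : ∀ i b, HomogeneousOfDegree (deg i) (d i (Finsupp.single b 1)) (deg (i + 1) b)
  aug_homogeneous : ∀ b, ∀ m ∈ (aug (Finsupp.single b 1) : MvPolynomial (Fin n) K).support,
    (m.degree : ℤ) = deg 0 b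
  aug_surjective : Function.Surjective aug
  exact_zero : Function.Exact (d 0) aug
  exact_succ : ∀ i, Function.Exact (d (i + 1)) (d i)

namespace GradedFreeResolution

variable {I : Ideal (MvPolynomial (Fin n) K)} (F : GradedFreeResolution.{u, v} I)

/-- The differential of `F ⊗_S K`, where `K = S / (x_1, …, x_n)`: here `F_i ⊗_S K` is the vector
space `⨁_{b : basis i} K(-deg i b)`, and the matrix of the differential consists of the constant
terms of the entries of the matrix of `d i`. -/
noncomputable def tensorD (i : ℕ) : (F.basis (i + 1) →₀ K) →ₗ[K] (F.basis i →₀ K) :=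
  Finsupp.linearCombination K fun b =>
    (F.d i (Finsupp.single b 1)).mapRange constantCoeff (map_zero _)

/-- The degree `j` component of `F_i ⊗_S K`. -/
def tensorComponent (i : ℕ) (j : ℤ) : Submodule K (F.basis i →₀ K) :=
  Finsupp.supported K K {b | F.deg i b = j}

/-- The cycles in homological degree `i` and internal degree `j` of `F ⊗_S K`. -/
noncomputable def cycles : (i : ℕ) → (j : ℤ) → Submodule K (F.basis i →₀ K)
  | 0, j => F.tensorComponent 0 j
  | i + 1, j => F.tensorComponent (i + 1) j ⊓ LinearMap.ker (F.tensorD i)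

/-- The boundaries in homological degree `i` and internal degree `j` of `F ⊗_S K`. -/
noncomputable def boundaries (i : ℕ) (j : ℤ) : Submodule K (F.basis i →₀ K) :=
  (F.tensorComponent (i + 1) j).map (F.tensorD i)

theorem tensorD_mapRange (i : ℕ) (x : F.basis (i + 1) →₀ MvPolynomial (Fin n) K) :
    F.tensorD i (x.mapRange constantCoeff (map_zero _)) =
      (F.d i x).mapRange constantCoeff (map_zero _) := by
  induction x using Finsupp.induction_linear with
  | zero => simp
  | add f g hf hg =>
    rw [Finsupp.mapRange_add (map_add _), map_add, hf, hg, map_add,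
      Finsupp.mapRange_add (map_add _)]
  | single b p =>
    have h : Finsupp.single b p =
        p • (Finsupp.single b 1 : F.basis (i + 1) →₀ MvPolynomial (Fin n) K) := by
      simp
    rw [Finsupp.mapRange_single, tensorD,
      Finsupp.linearCombination_single, h, map_smul]
    ext b'
    simp

theorem tensorD_comp (i : ℕ) (x) : F.tensorD i (F.tensorD (i + 1) x) = 0 := by
  induction x using Finsupp.induction_linear with
  | zero => simp
  | add f g hf hg => simp [hf, hg]
  | single b p =>
    have h := tensorD_mapRange F i (F.d (i + 1) (Finsupp.single b 1))
    rw [(F.exact_succ i).apply_apply_eq_zero] at h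
    rw [tensorD.eq_1 F (i + 1), Finsupp.linearCombination_single, map_smul, h]
    simp

theorem tensorD_component (i : ℕ) (j : ℤ) : (F.tensorComponent (i + 1) j).map (F.tensorD i) ≤
    F.tensorComponent i j := by
  rw [tensorComponent, Finsupp.supported_eq_span_single, Submodule.map_span,
    Submodule.span_le]
  rintro _ ⟨_, ⟨b, hb, rfl⟩, rfl⟩
  rw [tensorD, Finsupp.linearCombination_single, one_smul]
  intro b' hb'
  have h1 := F.d_homogeneous i b b' 0 (by
    rw [mem_support_iff]
    simpa [constantCoeff_eq] using hb')
  simp at h1 hb ⊢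
  omega

/-- `F ⊗_S K` is a complex of graded vector spaces, so that `Tor` below is cycles modulo
boundaries. -/
theorem boundaries_le_cycles (i : ℕ) (j : ℤ) : F.boundaries i j ≤ F.cycles i j := by
  cases i with
  | zero => exact tensorD_component F 0 j
  | succ i =>
    refine le_inf (tensorD_component F (i + 1) j) ?_
    rintro _ ⟨x, -, rfl⟩
    exact tensorD_comp F i x

/-- `Tor_i(I, K)_j`, computed from the graded free resolution `F` of `I`: the degree `j` component
of the `i`-th homology of `F ⊗_S K`. -/
abbrev Tor (i : ℕ) (j : ℤ) : Type (max u v) :=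
  Subquotient (F.cycles i j) (F.boundaries i j)

/-- The graded Betti number `β_{i,j}(I) = dim_K Tor_i(I, K)_j`, computed from `F`. -/
noncomputable def betti (i : ℕ) (j : ℤ) : ℕ := Module.finrank K (F.Tor i j)

end GradedFreeResolution

end Resolutions

/-! ### Symmetric shifted ideals

The monomial `x^a` is `monomial a 1`, and `x^a` divides `x^b` if and only if `a ≤ b`. A partition
of length `n` is a nondecreasing `λ : Fin n →₀ ℕ`; its size `|λ|` is `λ.degree`. -/

section Ideals

variable {n : ℕ} {K : Type u} [Field K]

/-- `I` is generated by monomials. -/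
def IsMonomialIdeal (I : Ideal (MvPolynomial (Fin n) K)) : Prop :=
  ∃ A : Set (Fin n →₀ ℕ), I = Ideal.span ((fun a => monomial a (1 : K)) '' A)

/-- `I` is fixed by all permutations of the variables. -/
def IsSymmetricIdeal (I : Ideal (MvPolynomial (Fin n) K)) : Prop :=
  ∀ σ : Equiv.Perm (Fin n), I.map (rename σ : _ →ₐ[K] MvPolynomial (Fin n) K) = I

/-- The set `P(I)` of all partitions `λ` with `x^λ ∈ I`. -/
def partitionsIn (I : Ideal (MvPolynomial (Fin n) K)) : Set (Fin n →₀ ℕ) :=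
  {a | Monotone a ∧ monomial a (1 : K) ∈ I}

/-- `I` is a symmetric shifted ideal: an `𝔖_n`-fixed monomial ideal such that for every
`λ ∈ P(I)` and `k < n` with `λ_k < λ_n` one has `x^λ (x_k / x_n) ∈ I`. (The last index is the
`l : Fin n` with `l + 1 = n`; `λ_l > 0`, so the subtraction below is not truncated.) -/
structure IsSymmetricShifted (I : Ideal (MvPolynomial (Fin n) K)) : Prop where
  monomial_ideal : IsMonomialIdeal I
  symmetric : IsSymmetricIdeal I
  shifted : ∀ a ∈ partitionsIn I, ∀ k l : Fin n, (l : ℕ) + 1 = n → k < l → a k < a l →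
    monomial (a - Finsupp.single l 1 + Finsupp.single k 1) (1 : K) ∈ I

/-- The exponents of the minimal monomial generators `G(I)`: the monomials of `I` that are minimal
for divisibility among the monomials of `I`. -/
def minimalGenerators (I : Ideal (MvPolynomial (Fin n) K)) : Set (Fin n →₀ ℕ) :=
  {a | Minimal (fun b => monomial b (1 : K) ∈ I) a}

/-- The partition generators `Λ(I) = {λ ∈ P(I) : x^λ ∈ G(I)}`. -/
def partitionGenerators (I : Ideal (MvPolynomial (Fin n) K)) : Set (Fin n →₀ ℕ) :=
  {a | a ∈ partitionsIn I ∧ a ∈ minimalGenerators I}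

open Classical in
/-- The finite set of all `λ ∈ Λ(I)` with `|λ| = d`. -/
noncomputable def partitionGeneratorsOfSize (I : Ideal (MvPolynomial (Fin n) K)) (d : ℕ) :
    Finset (Fin n →₀ ℕ) :=
  (Finset.univ.finsuppAntidiag d).filter (fun a => a ∈ partitionGenerators I)

theorem mem_partitionGeneratorsOfSize (I : Ideal (MvPolynomial (Fin n) K)) (d : ℕ)
    (a : Fin n →₀ ℕ) :
    a ∈ partitionGeneratorsOfSize I d ↔ a ∈ partitionGenerators I ∧ a.degree = d := by
  simp [partitionGeneratorsOfSize, Finset.mem_finsuppAntidiag, Finsupp.degree_eq_sum, and_comm]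

end Ideals

/-! ### The numerical data of a partition -/

section Numerics

variable {n : ℕ}

/-- The last entry `λ_n` (and `0` when `n = 0`). -/
def lastPart (a : Fin n →₀ ℕ) : ℕ :=
  if h : 0 < n then a ⟨n - 1, Nat.sub_lt h one_pos⟩ else 0

/-- `p(λ) = #{k : λ_k < λ_n - 1}`. -/
def pNum (a : Fin n →₀ ℕ) : ℕ := (Finset.univ.filter fun k => a k + 1 < lastPart a).card

/-- `r(λ) = #{k : λ_k = λ_n}`. -/
def rNum (a : Fin n →₀ ℕ) : ℕ := (Finset.univ.filter fun k => a k = lastPart a).card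

theorem pNum_le (a : Fin n →₀ ℕ) : pNum a ≤ n :=
  (Finset.card_le_univ _).trans_eq (Fintype.card_fin n)

/-- The truncation `λ_{≤ p(λ)} = (λ_1, …, λ_{p(λ)})`. -/
def truncation (a : Fin n →₀ ℕ) : Fin (pNum a) → ℕ := fun k => a (Fin.castLE (pNum_le a) k)

/-- `type(c)! = t_0! t_1! ⋯ t_d!` with `d = |c|` and `t_v = #{k : c_k = v}`. -/
def typeFactorial {m : ℕ} (c : Fin m → ℕ) : ℕ :=
  ∏ v ∈ Finset.range ((∑ k, c k) + 1), (Finset.univ.filter fun k => c k = v).card.factorial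

end Numerics

/-! ### Existence of graded free resolutions -/

section Existence
variable {n : ℕ} {K : Type u} [Field K]


/-- The degree `j` component of an element of `⨁_b S(-deg b)`. -/
noncomputable def component {B : Type u} (deg : B → ℤ) (j : ℤ) :
    (B →₀ MvPolynomial (Fin n) K) →ₗ[K] (B →₀ MvPolynomial (Fin n) K) where
  toFun x := Finsupp.onFinset x.support
    (fun b => if 0 ≤ j - deg b then homogeneousComponent (j - deg b).toNat (x b) else 0)
    (fun b h => by
      rw [Finsupp.mem_support_iff]
      intro h0
      simp [h0] at h)
  map_add' x y := by
    ext b : 1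
    simp only [Finsupp.onFinset_apply, Finsupp.add_apply]
    split_ifs <;> simp
  map_smul' c x := by
    ext b : 1
    simp only [Finsupp.onFinset_apply, Finsupp.smul_apply, RingHom.id_apply]
    split_ifs <;> simp

theorem coeff_component {B : Type u} (deg : B → ℤ) (j : ℤ) (x : B →₀ MvPolynomial (Fin n) K)
    (b : B) (m : Fin n →₀ ℕ) :
    coeff m (component deg j x b) = if (m.degree : ℤ) + deg b = j then coeff m (x b) else 0 := by
  simp only [component, LinearMap.coe_mk, AddHom.coe_mk, Finsupp.onFinset_apply]
  split_ifs with h1 h2 h2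
  · rw [coeff_homogeneousComponent, if_pos (by omega)]
  · rw [coeff_homogeneousComponent, if_neg (by omega)]
  · omega
  · simp

theorem component_of_homogeneous {B : Type u} {deg : B → ℤ} {j : ℤ}
    {x : B →₀ MvPolynomial (Fin n) K} (hx : HomogeneousOfDegree deg x j) (j' : ℤ) :
    component deg j' x = if j = j' then x else 0 := by
  ext b m
  rw [coeff_component]
  by_cases hm : coeff m (x b) = 0
  · split_ifs <;> simp [hm]
  · have := hx b m (by simpa [mem_support_iff] using hm)
    rw [this]
    split_ifs <;> simp

theorem homogeneous_component {B : Type u} (deg : B → ℤ) (j : ℤ)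
    (x : B →₀ MvPolynomial (Fin n) K) : HomogeneousOfDegree deg (component deg j x) j := by
  intro b m hm
  rw [mem_support_iff, coeff_component] at hm
  by_contra h
  simp [h] at hm

theorem sum_component {B : Type u} (deg : B → ℤ) (x : B →₀ MvPolynomial (Fin n) K) :
    ∃ T : Finset ℤ, ∑ j ∈ T, component deg j x = x := by
  classical
  refine ⟨x.support.biUnion fun b => (x b).support.image fun m => (m.degree : ℤ) + deg b, ?_⟩
  ext b m
  rw [Finsupp.finsetSum_apply, coeff_sum]
  simp only [coeff_component, Finset.sum_ite_eq]
  split_ifs with h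
  · rfl
  · by_contra hm
    refine h (Finset.mem_biUnion.2 ⟨b, ?_, Finset.mem_image.2 ⟨m, ?_, rfl⟩⟩)
    · rw [Finsupp.mem_support_iff]
      intro h0
      simp [h0] at hm
    · rw [mem_support_iff]
      exact fun h0 => hm h0.symm

/-- A graded submodule of a graded free module. -/
structure GradedSub (n : ℕ) (K : Type u) [Field K] where
  basis : Type u
  deg : basis → ℤ
  sub : Submodule (MvPolynomial (Fin n) K) (basis →₀ MvPolynomial (Fin n) K)
  graded : ∀ x ∈ sub, ∀ j, component deg j x ∈ sub

namespace GradedSub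

/-- All homogeneous elements of a graded submodule, with their degrees. -/
abbrev Gen (M : GradedSub n K) : Type u :=
  Σ j : ℤ, {x : M.basis →₀ MvPolynomial (Fin n) K // x ∈ M.sub ∧ HomogeneousOfDegree M.deg x j}

/-- The map to `M` from the free module on all homogeneous elements of `M`. -/
noncomputable def cover (M : GradedSub n K) :
    (M.Gen →₀ MvPolynomial (Fin n) K) →ₗ[MvPolynomial (Fin n) K]
      (M.basis →₀ MvPolynomial (Fin n) K) :=
  Finsupp.linearCombination _ fun g => g.2.1

theorem range_cover (M : GradedSub n K) : LinearMap.range M.cover = M.sub := by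
  rw [cover, Finsupp.range_linearCombination]
  apply le_antisymm
  · rw [Submodule.span_le]
    rintro _ ⟨g, rfl⟩
    exact g.2.2.1
  · intro x hx
    obtain ⟨T, hT⟩ := sum_component M.deg x
    rw [← hT]
    refine Submodule.sum_mem _ fun j _ => Submodule.subset_span ?_
    exact ⟨⟨j, component M.deg j x, M.graded x hx j, homogeneous_component _ _ _⟩, rfl⟩

theorem cover_component (M : GradedSub n K) (y : M.Gen →₀ MvPolynomial (Fin n) K) (j : ℤ) :
    M.cover (component (fun g : M.Gen => g.1) j y) = component M.deg j (M.cover y) := by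
  induction y using Finsupp.induction_linear with
  | zero => simp
  | add f g hf hg => simp only [map_add, hf, hg]
  | single g p =>
    induction p using MvPolynomial.induction_on' with
    | add p q hp hq => simp only [Finsupp.single_add, map_add, hp, hq]
    | monomial m c =>
      have h1 : HomogeneousOfDegree (fun g : M.Gen => g.1)
          (Finsupp.single g (monomial m c)) ((m.degree : ℤ) + g.1) := by
        classical
        intro b m' hm'
        rw [Finsupp.single_apply] at hm'
        split_ifs at hm' with h
        · subst h
          have := support_monomial_subset hm'
          rw [Finset.mem_singleton] at this
          rw [this]
        · simp at hm'
      have h2 : HomogeneousOfDegree M.deg (M.cover (Finsupp.single g (monomial m c)))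
          ((m.degree : ℤ) + g.1) := by
        classical
        intro b m' hm'
        rw [cover, Finsupp.linearCombination_single, Finsupp.smul_apply, smul_eq_mul,
          mem_support_iff, coeff_monomial_mul'] at hm'
        split_ifs at hm' with h
        · have := g.2.2.2 b (m' - m) (by
            rw [mem_support_iff]
            exact right_ne_zero_of_mul hm')
          have h3 : m' = m + (m' - m) := (add_tsub_cancel_of_le h).symm
          rw [h3, map_add, Nat.cast_add, add_assoc, this]
        · exact absurd rfl hm'
      rw [component_of_homogeneous h1, component_of_homogeneous h2]
      split_ifs <;> simp

/-- The syzygies of the homogeneous elements of `M`. -/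
noncomputable def next (M : GradedSub n K) : GradedSub n K where
  basis := M.Gen
  deg g := g.1
  sub := LinearMap.ker M.cover
  graded x hx j := by
    rw [LinearMap.mem_ker] at hx ⊢
    rw [cover_component, hx, map_zero]

end GradedSub

/-- A monomial ideal as a graded submodule of the free module of rank one. -/
noncomputable def GradedSub.ofIdeal (I : Ideal (MvPolynomial (Fin n) K))
    (hI : IsMonomialIdeal I) : GradedSub n K where
  basis := PUnit
  deg _ := 0
  sub := Submodule.comap (Finsupp.lapply PUnit.unit :
    (PUnit.{u + 1} →₀ MvPolynomial (Fin n) K) →ₗ[MvPolynomial (Fin n) K] _) I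
  graded x hx j := by
    obtain ⟨A, rfl⟩ := hI
    rw [Submodule.mem_comap, Finsupp.lapply_apply, mem_ideal_span_monomial_image] at hx ⊢
    intro m hm
    refine hx m ?_
    rw [mem_support_iff, coeff_component] at hm
    rw [mem_support_iff]
    intro h0
    simp [h0] at hm

/-- The iterated syzygies of a graded submodule. -/
noncomputable def GradedSub.syz (M : GradedSub n K) : ℕ → GradedSub n K
  | 0 => M
  | i + 1 => (M.syz i).next

/-- Every monomial ideal has a graded free resolution. -/
theorem nonempty_gradedFreeResolution {I : Ideal (MvPolynomial (Fin n) K)}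
    (hI : IsMonomialIdeal I) : Nonempty (GradedFreeResolution.{u, u} I) := by
  let M := GradedSub.ofIdeal I hI
  have hc : ∀ (N : GradedSub n K) (g : N.Gen),
      HomogeneousOfDegree N.deg (N.cover (Finsupp.single g 1)) g.1 := by
    intro N g
    simpa [GradedSub.cover] using g.2.2.2
  have hr : ∀ (N : GradedSub n K) (x), x ∈ N.sub ↔ x ∈ Set.range N.cover := by
    intro N x
    rw [← N.range_cover]
    rfl
  refine ⟨{
    basis := fun i => (M.syz i).Gen
    deg := fun i g => g.1
    d := fun i => (M.syz (i + 1)).cover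
    aug := LinearMap.codRestrict I ((Finsupp.lapply PUnit.unit :
      (M.basis →₀ MvPolynomial (Fin n) K) →ₗ[MvPolynomial (Fin n) K] _).comp M.cover)
      fun x => (hr M _).2 ⟨x, rfl⟩
    d_homogeneous := fun i g => hc (M.syz (i + 1)) g
    aug_homogeneous := ?_
    aug_surjective := ?_
    exact_zero := ?_
    exact_succ := fun i x => ?_ }⟩
  · intro g m hm
    have := hc M g PUnit.unit m hm
    simpa [M, GradedSub.ofIdeal] using this
  · rintro ⟨y, hy⟩
    have h1 : (Finsupp.single PUnit.unit y : PUnit →₀ MvPolynomial (Fin n) K) ∈ M.sub := by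
      change (Finsupp.single PUnit.unit y : PUnit →₀ MvPolynomial (Fin n) K) PUnit.unit ∈ I
      rwa [Finsupp.single_eq_same]
    obtain ⟨x, hx⟩ := (hr M _).1 h1
    refine ⟨x, Subtype.ext ?_⟩
    change M.cover x PUnit.unit = y
    rw [hx]
    exact Finsupp.single_eq_same
  · intro x
    refine Iff.trans ?_ (hr (M.syz 1) x)
    change _ ↔ M.cover x = 0
    rw [Subtype.ext_iff]
    change M.cover x PUnit.unit = 0 ↔ _
    constructor
    · intro h
      exact Finsupp.ext fun _ => h
    · intro h
      rw [h]
      rfl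
  · exact hr (M.syz (i + 2)) x

end Existence

end SymShifted

namespace SymShifted

set_option linter.unusedSectionVars false

/-! ### Subquotients -/

section Subquotients

variable {K : Type*} [Field K]

/-! The ideal has linear quotients. Order the minimal generators by degree, then by the sum of the
squares of the exponents, then with the lexicographically larger exponent first. The colon ideal of
the earlier generators by `x^u` is generated by the variables in `colonSet u`: with M the largest
entry of u, the `x_k` with `u_k < M - 1`, and those with `u_k = M - 1` that have an entry M to their
right. `exists_colon` shows that these variables lie in the colon ideal, by moving a unit from a
maximal entry to entry k; `exists_mem_colonSet` shows that nothing more does, by an exchange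
argument and convexity of the square. So each generator u contributes `(colonSet u).card.choose i`
to the Betti number in degree `i + |u|`.

To obtain this for an arbitrary graded free resolution, `nonempty_koszulHomology_equiv_tor`
identifies Tor with the Koszul homology of I by dimension shifting. The Koszul homology of `S/(x_k :
k ∈ A)` is the exterior algebra on A, with a single internal degree in each homological degree.
Generators are added one at a time, and the connecting maps vanish for degree reasons because the
degrees of the generators never decrease (`finite_finrank_koszulHomology_of_linearQuotients`).

It remains to sum over the rearrangements of each λ. The size of `colonSet` depends only on the
pattern recording which entries are below M - 1, equal to M - 1, or equal to M. Passing from λ to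
its pattern costs the ratio of stabilizer orders, which is `p! / type!`
(`typeFactorial_mul_stabCard`). For patterns one chooses the p small positions and the set R of
maximal positions; Vandermonde splits i into k + l. A set R with k further positions, each left of
some element of R, is the same as an (r+k)-set with a k-subset avoiding its maximum
(`sum_powersetCard_choose`). -/

theorem subquotient_equiv {R V₁ V₂ : Type*} [AddCommGroup R] [Module K R] [AddCommGroup V₁]
    [Module K V₁] [AddCommGroup V₂] [Module K V₂] {Z₁ W₁ : Submodule K V₁} {Z₂ W₂ : Submodule K V₂}
    (a : R →ₗ[K] V₁) (b : R →ₗ[K] V₂) (ha : ∀ r, a r ∈ Z₁) (hb : ∀ r, b r ∈ Z₂)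
    (ha' : ∀ z ∈ Z₁, ∃ r, z - a r ∈ W₁) (hb' : ∀ z ∈ Z₂, ∃ r, z - b r ∈ W₂)
    (h : ∀ r, a r ∈ W₁ ↔ b r ∈ W₂) :
    Nonempty (Subquotient Z₁ W₁ ≃ₗ[K] Subquotient Z₂ W₂) := by
  let f₁ : R →ₗ[K] Subquotient Z₁ W₁ := (W₁.submoduleOf Z₁).mkQ.comp (a.codRestrict Z₁ ha)
  let f₂ : R →ₗ[K] Subquotient Z₂ W₂ := (W₂.submoduleOf Z₂).mkQ.comp (b.codRestrict Z₂ hb)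
  have s₁ : Function.Surjective f₁ := by
    intro q
    obtain ⟨⟨z, hz⟩, rfl⟩ := Submodule.mkQ_surjective _ q
    obtain ⟨r, hr⟩ := ha' z hz
    refine ⟨r, ((Submodule.Quotient.eq _).2 ?_).symm⟩
    exact hr
  have s₂ : Function.Surjective f₂ := by
    intro q
    obtain ⟨⟨z, hz⟩, rfl⟩ := Submodule.mkQ_surjective _ q
    obtain ⟨r, hr⟩ := hb' z hz
    refine ⟨r, ((Submodule.Quotient.eq _).2 ?_).symm⟩
    exact hr
  -- Both subquotients are images of `R`, so it suffices that the two kernels agree.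
  have e : LinearMap.ker f₁ = LinearMap.ker f₂ := by
    ext r
    rw [LinearMap.mem_ker, LinearMap.mem_ker]
    change Submodule.Quotient.mk _ = _ ↔ Submodule.Quotient.mk _ = _
    rw [Submodule.Quotient.mk_eq_zero, Submodule.Quotient.mk_eq_zero]
    exact h r
  exact ⟨(f₁.quotKerEquivOfSurjective s₁).symm.trans
    ((Submodule.quotEquivOfEq _ _ e).trans (f₂.quotKerEquivOfSurjective s₂))⟩

theorem finite_finrank_of_shortExact {U V W : Type*} [AddCommGroup U] [Module K U] [AddCommGroup V]
    [Module K V] [AddCommGroup W] [Module K W] [Module.Finite K U] [Module.Finite K W]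
    (f : U →ₗ[K] V) (g : V →ₗ[K] W) (hf : Function.Injective f) (hg : Function.Surjective g)
    (h : Function.Exact f g) :
    Module.Finite K V ∧ Module.finrank K V = Module.finrank K U + Module.finrank K W := by
  have e : LinearMap.ker g = LinearMap.range f := LinearMap.exact_iff.1 h
  have : Module.Finite K V := by
    have h1 : (LinearMap.ker g).FG := by
      rw [e]
      exact Module.Finite.iff_fg.1 inferInstance
    refine ⟨Submodule.fg_of_fg_map_of_fg_inf_ker g ?_ (by simpa using h1)⟩
    rw [Submodule.map_top, LinearMap.range_eq_top.2 hg]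
    exact Module.Finite.fg_top
  refine ⟨this, ?_⟩
  rw [← LinearMap.finrank_range_add_finrank_ker g, e, LinearMap.finrank_range_of_inj hf,
    LinearMap.range_eq_top.2 hg, finrank_top, add_comm]

/-- A sequence of subquotients which is short exact on the level of representatives. -/
theorem finite_finrank_subquotient {V₁ V₂ : Type*} [AddCommGroup V₁]
    [Module K V₁] [AddCommGroup V₂] [Module K V₂] {Z' W' Z W : Submodule K V₁}
    {Z'' W'' : Submodule K V₂} (b : V₁ →ₗ[K] V₂) (hZ : Z' ≤ Z) (hW : W' ≤ W)
    (hbZ : ∀ z ∈ Z, b z ∈ Z'') (hbW : ∀ z ∈ W, b z ∈ W'') (hinj : ∀ z ∈ Z', z ∈ W → z ∈ W')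
    (hex : ∀ z ∈ Z, b z ∈ W'' → ∃ z' ∈ Z', z - z' ∈ W) (hz : ∀ z ∈ Z', b z = 0)
    (hsurj : ∀ z ∈ Z'', ∃ y ∈ Z, z - b y ∈ W'')
    (h' : Module.Finite K (Subquotient Z' W')) (h'' : Module.Finite K (Subquotient Z'' W'')) :
    Module.Finite K (Subquotient Z W) ∧ Module.finrank K (Subquotient Z W) =
      Module.finrank K (Subquotient Z' W') + Module.finrank K (Subquotient Z'' W'') := by
  let f : Subquotient Z' W' →ₗ[K] Subquotient Z W :=
    Submodule.mapQ _ _ (Submodule.inclusion hZ) (fun x hx => hW hx)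
  let g : Subquotient Z W →ₗ[K] Subquotient Z'' W'' :=
    Submodule.mapQ _ _ (b.restrict hbZ) (fun x hx => hbW _ hx)
  refine finite_finrank_of_shortExact f g ?_ ?_ ?_
  · rw [← LinearMap.ker_eq_bot, LinearMap.ker_eq_bot']
    intro q hq
    obtain ⟨⟨z, hz'⟩, rfl⟩ := Submodule.mkQ_surjective _ q
    have : z ∈ W := (Submodule.Quotient.mk_eq_zero (W.submoduleOf Z)).1 hq
    exact (Submodule.Quotient.mk_eq_zero (W'.submoduleOf Z')).2 (hinj z hz' this)
  · intro q
    obtain ⟨⟨z, hz'⟩, rfl⟩ := Submodule.mkQ_surjective _ q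
    obtain ⟨y, hy, hyz⟩ := hsurj z hz'
    exact ⟨Submodule.Quotient.mk ⟨y, hy⟩, ((Submodule.Quotient.eq (W''.submoduleOf Z'')).2 hyz).symm⟩
  · intro q
    obtain ⟨⟨z, hz'⟩, rfl⟩ := Submodule.mkQ_surjective _ q
    constructor
    · intro hq
      have : b z ∈ W'' := (Submodule.Quotient.mk_eq_zero (W''.submoduleOf Z'')).1 hq
      obtain ⟨z', hz1, hz2⟩ := hex z hz' this
      exact ⟨Submodule.Quotient.mk ⟨z', hz1⟩, ((Submodule.Quotient.eq (W.submoduleOf Z)).2 hz2).symm⟩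
    · rintro ⟨q', hq'⟩
      obtain ⟨⟨z', hz1⟩, rfl⟩ := Submodule.mkQ_surjective _ q'
      rw [← hq']
      refine (Submodule.Quotient.mk_eq_zero (W''.submoduleOf Z'')).2 ?_
      change b z' ∈ W''
      rw [hz z' hz1]
      exact W''.zero_mem

end Subquotients

/-! ### Koszul homology -/

section Koszul

variable {ι : Type*} [LinearOrder ι] {K : Type*} [Field K]

/-- The sign of `k` relative to `A`: the parity of the number of elements of `A` below `k`. -/
def koszulSign (K : Type*) [Field K] (k : ι) (A : Finset ι) : K := (-1) ^ (A.filter (· < k)).card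

theorem koszulSign_mul_self (k : ι) (A : Finset ι) : koszulSign K k A * koszulSign K k A = 1 := by
  rw [koszulSign, ← mul_pow]
  simp

theorem koszulSign_insert_self (k : ι) (A : Finset ι) :
    koszulSign K k (insert k A) = koszulSign K k A := by
  simp [koszulSign, Finset.filter_insert]

theorem koszulSign_insert {k l : ι} {A : Finset ι} (hl : l ∉ A) :
    koszulSign K k (insert l A) = if l < k then -koszulSign K k A else koszulSign K k A := by
  rw [koszulSign, koszulSign, Finset.filter_insert]
  split_ifs with h
  · rw [Finset.card_insert_of_notMem (by simp [hl]), pow_succ]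
    ring
  · rfl

/-- Of two distinct indices exactly one is below the other, so exactly one of the two insertions
changes a sign. This gives `d² = 0`; the primed variant serves the homotopy formula. -/
theorem koszulSign_comm {k l : ι} {A : Finset ι} (hk : k ∉ A) (hl : l ∉ A) (hkl : k ≠ l) :
    koszulSign K k A * koszulSign K l (insert k A) =
      -(koszulSign K l A * koszulSign K k (insert l A)) := by
  rw [koszulSign_insert hk, koszulSign_insert hl]
  rcases lt_or_gt_of_ne hkl with h | h
  · rw [if_pos h, if_neg h.not_gt]
    ring
  · rw [if_pos h, if_neg h.not_gt]
    ring

theorem koszulSign_comm' {k l : ι} {A : Finset ι} (hk : k ∉ A) (hl : l ∉ A) (hkl : k ≠ l) :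
    koszulSign K l (insert k A) * koszulSign K k (insert l A) =
      -(koszulSign K k A * koszulSign K l A) := by
  rw [koszulSign_insert hk, koszulSign_insert hl]
  rcases lt_or_gt_of_ne hkl with h | h
  · rw [if_pos h, if_neg h.not_gt]
    ring
  · rw [if_pos h, if_neg h.not_gt]
    ring

variable [Fintype ι] {M : Type*} [AddCommGroup M] [Module K M]

/-- The Koszul differential of a vector space with operators `x k`. A chain `f` stands for
`∑ A, f A ⊗ e_A`. -/
def koszulD (x : ι → Module.End K M) : (Finset ι → M) →ₗ[K] (Finset ι → M) where
  toFun f A := ∑ k ∈ Aᶜ, koszulSign K k A • x k (f (insert k A))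
  map_add' f g := by
    ext A
    simp [Finset.sum_add_distrib]
  map_smul' c f := by
    ext A
    simp [Finset.smul_sum, smul_comm c]

theorem koszulD_apply (x : ι → Module.End K M) (f : Finset ι → M) (A : Finset ι) :
    koszulD x f A = ∑ k ∈ Aᶜ, koszulSign K k A • x k (f (insert k A)) := rfl

theorem koszulD_koszulD {x : ι → Module.End K M} (hx : ∀ k l m, x k (x l m) = x l (x k m))
    (f : Finset ι → M) : koszulD x (koszulD x f) = 0 := by
  ext A
  simp only [koszulD_apply, map_sum, map_smul, Finset.smul_sum, smul_smul, Pi.zero_apply]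
  rw [Finset.sum_sigma']
  -- Exchanging the two inserted indices pairs each term with its negative.
  refine Finset.sum_involution (fun p _ => ⟨p.2, p.1⟩) ?_ ?_ ?_ ?_
  · rintro ⟨k, l⟩ h
    simp only [Finset.mem_sigma, Finset.mem_compl, Finset.mem_insert, not_or] at h
    dsimp only
    rw [hx l k, Finset.insert_comm, koszulSign_comm h.1 h.2.2 (Ne.symm h.2.1), neg_smul,
      neg_add_cancel]
  · rintro ⟨k, l⟩ h _ h'
    simp only [Finset.mem_sigma, Finset.mem_compl, Finset.mem_insert, not_or] at h
    simp only [Sigma.mk.injEq] at h'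
    exact h.2.1 h'.1
  · rintro ⟨k, l⟩ h
    simp only [Finset.mem_sigma, Finset.mem_compl, Finset.mem_insert, not_or] at h ⊢
    exact ⟨h.2.2, fun e => h.2.1 e.symm, h.1⟩
  · rintro ⟨k, l⟩ _
    rfl

/-- The homotopy given by a division `D` by the `k`-th variable. -/
def koszulHomotopy (k : ι) (D : Module.End K M) (f : Finset ι → M) : Finset ι → M :=
  fun A => if k ∈ A then koszulSign K k A • D (f (A.erase k)) else 0

/-- For a cycle `f`, subtracting the boundary of its homotopy image kills the components containing
`k` and leaves in the others the remainder on division by `x k`. -/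
theorem koszulD_homotopy {x : ι → Module.End K M} {k : ι} {D : Module.End K M}
    (hD : ∀ m, D (x k m) = m) (hD' : ∀ l, l ≠ k → ∀ m, D (x l m) = x l (D m))
    (f : Finset ι → M) (A : Finset ι) :
    koszulD x (koszulHomotopy k D f) A + koszulHomotopy k D (koszulD x f) A =
      if k ∈ A then f A else x k (D (f A)) := by
  by_cases hk : k ∈ A
  · obtain ⟨B, hB, rfl⟩ : ∃ B, k ∉ B ∧ A = insert k B :=
      ⟨A.erase k, Finset.notMem_erase k A, (Finset.insert_erase hk).symm⟩
    rw [if_pos hk, koszulHomotopy, if_pos hk, Finset.erase_insert hB, koszulD_apply, koszulD_apply]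
    -- The index `k` in `koszulD x f B` gives back `f (insert k B)`; the other terms cancel against
    -- the differential of the homotopy.
    have hc : Bᶜ = insert k (insert k B)ᶜ := by
      ext l
      by_cases h : l = k
      · simp [h, hB]
      · simp [h]
    rw [hc, Finset.sum_insert (by simp), map_add, map_smul, hD, smul_add, smul_smul,
      koszulSign_insert_self, koszulSign_mul_self, one_smul, map_sum, Finset.smul_sum,
      add_comm (f _), ← add_assoc, ← Finset.sum_add_distrib]
    rw [add_eq_right]
    refine Finset.sum_eq_zero fun l hl => ?_
    simp only [Finset.mem_compl, Finset.mem_insert, not_or] at hl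
    have he : (insert l (insert k B)).erase k = insert l B := by
      rw [Finset.insert_comm, Finset.erase_insert (by simp [hB, Ne.symm hl.1])]
    rw [koszulHomotopy, if_pos (by simp), he, map_smul, map_smul, hD' l hl.1, smul_smul, smul_smul,
      ← add_smul, Finset.insert_comm, koszulSign_insert_self,
      koszulSign_comm' hB hl.2 (Ne.symm hl.1), neg_add_cancel, zero_smul]
  · rw [if_neg hk]
    have h0 : koszulHomotopy k D (koszulD x f) A = 0 := if_neg hk
    rw [h0, add_zero, koszulD_apply, Finset.sum_eq_single k]
    · rw [koszulHomotopy, if_pos (by simp), Finset.erase_insert hk, map_smul, smul_smul,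
        koszulSign_insert_self, koszulSign_mul_self, one_smul]
    · intro l _ hl
      rw [koszulHomotopy, if_neg (by simp [hk, Ne.symm hl]), map_zero, smul_zero]
    · intro h
      exact absurd (Finset.mem_compl.2 hk) h

/-- The Koszul chains of homological degree `i` and internal degree `j`. -/
def koszulChains (gr : ℤ → Submodule K M) (i : ℕ) (j : ℤ) : Submodule K (Finset ι → M) where
  carrier := {f : Finset ι → M | (∀ A : Finset ι, A.card = i → f A ∈ gr (j - i)) ∧
    ∀ A : Finset ι, A.card ≠ i → f A = 0}
  add_mem' := fun {f g} hf hg => ⟨fun A hA => (gr _).add_mem (hf.1 A hA) (hg.1 A hA), fun A hA => by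
    rw [Pi.add_apply, hf.2 A hA, hg.2 A hA, add_zero]⟩
  zero_mem' := ⟨fun _ _ => (gr _).zero_mem, fun _ _ => rfl⟩
  smul_mem' := fun c f hf => ⟨fun A hA => (gr _).smul_mem c (hf.1 A hA), fun A hA => by
    rw [Pi.smul_apply, hf.2 A hA, smul_zero]⟩

/-- The family `gr` is stable under the commuting operators `x k` of degree one. -/
structure IsGradedFor (x : ι → Module.End K M) (gr : ℤ → Submodule K M) : Prop where
  comm : ∀ k l m, x k (x l m) = x l (x k m)
  act : ∀ k j, ∀ m ∈ gr j, x k m ∈ gr (j + 1)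

variable {x : ι → Module.End K M} {gr : ℤ → Submodule K M}

theorem IsGradedFor.koszulD_mem (h : IsGradedFor x gr) {i : ℕ} {j : ℤ} {f : Finset ι → M}
    (hf : f ∈ koszulChains gr (i + 1) j) : koszulD x f ∈ koszulChains gr i j := by
  refine ⟨fun A hA => ?_, fun A hA => ?_⟩
  · rw [koszulD_apply]
    refine Submodule.sum_mem _ fun k hk => Submodule.smul_mem _ _ ?_
    have h1 := hf.1 (insert k A) (by
      rw [Finset.card_insert_of_notMem (Finset.mem_compl.1 hk), hA])
    have h2 := h.act k _ _ h1
    convert h2 using 2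
    push_cast
    ring
  · rw [koszulD_apply]
    refine Finset.sum_eq_zero fun k hk => ?_
    rw [hf.2 (insert k A) (by
      rw [Finset.card_insert_of_notMem (Finset.mem_compl.1 hk)]
      omega), map_zero, smul_zero]

theorem koszulD_chains_zero {j : ℤ} {f : Finset ι → M} (hf : f ∈ koszulChains gr 0 j) :
    koszulD x f = 0 := by
  ext A
  rw [koszulD_apply]
  refine Finset.sum_eq_zero fun k hk => ?_
  rw [hf.2 (insert k A) (by simp), map_zero, smul_zero]

/-- The Koszul cycles. -/
def koszulCycles (x : ι → Module.End K M) (gr : ℤ → Submodule K M) (i : ℕ) (j : ℤ) :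
    Submodule K (Finset ι → M) := koszulChains gr i j ⊓ LinearMap.ker (koszulD x)

/-- The Koszul boundaries. -/
def koszulBoundaries (x : ι → Module.End K M) (gr : ℤ → Submodule K M) (i : ℕ) (j : ℤ) :
    Submodule K (Finset ι → M) := (koszulChains gr (i + 1) j).map (koszulD x)

/-- Koszul homology. -/
abbrev KoszulHomology (x : ι → Module.End K M) (gr : ℤ → Submodule K M) (i : ℕ) (j : ℤ) :
    Type _ := Subquotient (koszulCycles x gr i j) (koszulBoundaries x gr i j)

theorem IsGradedFor.boundaries_le (h : IsGradedFor x gr) (i : ℕ) (j : ℤ) :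
    koszulBoundaries x gr i j ≤ koszulCycles x gr i j := by
  rintro _ ⟨f, hf, rfl⟩
  exact ⟨h.koszulD_mem hf, koszulD_koszulD h.comm f⟩

/-- If there are divisions `D k` for all `k ∈ T`, then a cycle is a boundary as soon as its
"constant terms" outside `T` vanish. -/
theorem mem_koszulBoundaries_of_division (h : IsGradedFor x gr) (T : Finset ι)
    (D : ι → Module.End K M) (hD : ∀ k ∈ T, ∀ m, D k (x k m) = m)
    (hD' : ∀ k ∈ T, ∀ l, l ≠ k → ∀ m, D k (x l m) = x l (D k m))
    (hDD : ∀ k ∈ T, ∀ l ∈ T, ∀ m, D k (D l m) = D l (D k m))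
    (hDgr : ∀ k ∈ T, ∀ j, ∀ m ∈ gr j, D k m ∈ gr (j - 1))
    {W : Type*} [AddCommGroup W] [Module K W] (c : M →ₗ[K] W) (hc : ∀ k m, c (x k m) = 0)
    (hred : ∀ j, ∀ m ∈ gr j, (∀ k ∈ T, D k m = 0) → c m = 0 → m = 0)
    {i : ℕ} {j : ℤ} {z : Finset ι → M} (hz : z ∈ koszulCycles x gr i j)
    (hcz : ∀ A, Disjoint A T → c (z A) = 0) : z ∈ koszulBoundaries x gr i j := by
  -- The indices in `T` are eliminated one at a time: `z - y` has no component meeting `U`, and its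
  -- values are remainders, killed by every `D k` with `k ∈ U`. Commutation of the divisions
  -- preserves what was achieved before.
  have key : ∀ U : Finset ι, U ⊆ T → ∃ y ∈ koszulBoundaries x gr i j,
      (∀ A, ∀ k ∈ U, D k ((z - y) A) = 0) ∧ (∀ A, ∀ k ∈ U, k ∈ A → (z - y) A = 0) := by
    intro U
    induction U using Finset.induction_on with
    | empty => exact fun _ => ⟨0, Submodule.zero_mem _, by simp, by simp⟩
    | insert k U hk ih =>
      intro hU
      rw [Finset.insert_subset_iff] at hU
      obtain ⟨y, hy, h1, h2⟩ := ih hU.2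
      have hzy : z - y ∈ koszulCycles x gr i j :=
        Submodule.sub_mem _ hz (h.boundaries_le i j hy)
      have hw : koszulHomotopy k (D k) (z - y) ∈ koszulChains gr (i + 1) j := by
        refine ⟨fun A hA => ?_, fun A hA => ?_⟩
        · rw [koszulHomotopy]
          split_ifs with hkA
          · refine Submodule.smul_mem _ _ ?_
            have := hDgr k hU.1 _ _ (hzy.1.1 (A.erase k) (by
              rw [Finset.card_erase_of_mem hkA, hA, Nat.add_sub_cancel]))
            convert this using 2
            push_cast
            ring
          · exact Submodule.zero_mem _
        · rw [koszulHomotopy]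
          split_ifs with hkA
          · rw [hzy.1.2 (A.erase k), map_zero, smul_zero]
            have := Finset.card_pos.2 ⟨k, hkA⟩
            rw [Finset.card_erase_of_mem hkA]
            omega
          · rfl
      have hval : ∀ A, (z - (y + koszulD x (koszulHomotopy k (D k) (z - y)))) A =
          if k ∈ A then 0 else (z - y) A - x k (D k ((z - y) A)) := by
        intro A
        have h3 := koszulD_homotopy (hD k hU.1) (hD' k hU.1) (z - y) A
        have h4 : koszulD x (z - y) = 0 := hzy.2
        have h5 : koszulHomotopy k (D k) (0 : Finset ι → M) A = 0 := by
          simp [koszulHomotopy]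
        rw [h4, h5, add_zero] at h3
        rw [← sub_sub, Pi.sub_apply, h3]
        split_ifs <;> simp
      refine ⟨y + koszulD x (koszulHomotopy k (D k) (z - y)),
        Submodule.add_mem _ hy ⟨_, hw, rfl⟩, fun A l hl => ?_, fun A l hl hlA => ?_⟩
      · rw [hval]
        split_ifs with hkA
        · exact map_zero _
        · rcases Finset.mem_insert.1 hl with rfl | hlU
          · rw [map_sub, hD l hU.1, sub_self]
          · have hlk : k ≠ l := fun e => hk (e ▸ hlU)
            rw [map_sub, hD' l (hU.2 hlU) k hlk, hDD l (hU.2 hlU) k hU.1, h1 A l hlU]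
            simp
      · rw [hval]
        rcases Finset.mem_insert.1 hl with rfl | hlU
        · rw [if_pos hlA]
        · rw [h2 A l hlU hlA]
          simp
  obtain ⟨y, hy, h1, h2⟩ := key T subset_rfl
  have hzy : z - y ∈ koszulCycles x gr i j := Submodule.sub_mem _ hz (h.boundaries_le i j hy)
  -- Boundaries have no constant terms, so subtracting `y` leaves those of `z` unchanged.
  have hcy : ∀ A, c (y A) = 0 := by
    intro A
    obtain ⟨w, _, rfl⟩ := hy
    rw [koszulD_apply, map_sum]
    refine Finset.sum_eq_zero fun k _ => ?_
    rw [map_smul, hc, smul_zero]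
  suffices z - y = 0 by
    rw [sub_eq_zero] at this
    rwa [this]
  ext A
  by_cases hA : Disjoint A T
  · by_cases hi : A.card = i
    · refine hred _ _ (hzy.1.1 A hi) (h1 A) ?_
      rw [Pi.sub_apply, map_sub, hcy, hcz A hA, sub_zero]
    · exact hzy.1.2 A hi
  · obtain ⟨k, hkA, hkT⟩ := Finset.not_disjoint_iff.1 hA
    exact h2 A k hkT hkA

end Koszul

/-! ### Short exact sequences and Koszul homology -/

section KoszulExact

variable {ι : Type*} {K : Type*} [Field K]
  {M N : Type*} [AddCommGroup M] [Module K M] [AddCommGroup N] [Module K N]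

theorem koszulChains_mono {gr' gr : ℤ → Submodule K M} (h : ∀ j, gr' j ≤ gr j) (i : ℕ) (j : ℤ) :
    (koszulChains gr' i j : Submodule K (Finset ι → M)) ≤ koszulChains gr i j :=
  fun _ hf => ⟨fun A hA => h _ (hf.1 A hA), hf.2⟩

end KoszulExact

section KoszulExact

variable {ι : Type*} [LinearOrder ι] [Fintype ι] {K : Type*} [Field K]
  {M N : Type*} [AddCommGroup M] [Module K M] [AddCommGroup N] [Module K N]

/-- A short exact sequence `0 → gr' → gr → gr'' → 0` of graded modules, where `gr'` and `gr` have
the same ambient module. -/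
structure IsKoszulExact (x : ι → Module.End K M) (y : ι → Module.End K N)
    (gr' gr : ℤ → Submodule K M) (gr'' : ℤ → Submodule K N) (b : M →ₗ[K] N) : Prop where
  mid : IsGradedFor x gr
  le : ∀ j, gr' j ≤ gr j
  equivariant : ∀ k j, ∀ m ∈ gr j, b (x k m) = y k (b m)
  map : ∀ j, ∀ m ∈ gr j, b m ∈ gr'' j
  surj : ∀ j, ∀ q ∈ gr'' j, ∃ m ∈ gr j, b m = q
  ker : ∀ j, ∀ m ∈ gr j, b m = 0 ↔ m ∈ gr' j

namespace IsKoszulExact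

variable {x : ι → Module.End K M} {y : ι → Module.End K N}
    {gr' gr : ℤ → Submodule K M} {gr'' : ℤ → Submodule K N} {b : M →ₗ[K] N}
    {i : ℕ} {j : ℤ} (h : IsKoszulExact x y gr' gr gr'' b)
include h

theorem map_chains {f : Finset ι → M} (hf : f ∈ koszulChains gr i j) :
    b.compLeft (Finset ι) f ∈ koszulChains gr'' i j :=
  ⟨fun A hA => h.map _ _ (hf.1 A hA), fun A hA => by
    rw [LinearMap.compLeft_apply, Function.comp_apply, hf.2 A hA, map_zero]⟩

theorem map_koszulD {f : Finset ι → M} (hf : f ∈ koszulChains gr i j) :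
    b.compLeft (Finset ι) (koszulD x f) = koszulD y (b.compLeft (Finset ι) f) := by
  ext A
  simp only [koszulD_apply, LinearMap.compLeft_apply, Function.comp_apply, map_sum, map_smul]
  refine Finset.sum_congr rfl fun k _ => ?_
  by_cases hi : (insert k A).card = i
  · rw [h.equivariant k _ _ (hf.1 _ hi)]
  · rw [hf.2 _ hi]
    simp

theorem lift_chains {g : Finset ι → N} (hg : g ∈ koszulChains gr'' i j) :
    ∃ f ∈ koszulChains gr i j, b.compLeft (Finset ι) f = g := by
  classical
  have h1 : ∀ A : Finset ι, ∃ m, (A.card = i → m ∈ gr (j - i)) ∧ (A.card ≠ i → m = 0) ∧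
      b m = g A := by
    intro A
    by_cases hA : A.card = i
    · obtain ⟨m, hm, hm'⟩ := h.surj _ _ (hg.1 A hA)
      exact ⟨m, fun _ => hm, fun h' => absurd hA h', hm'⟩
    · exact ⟨0, fun h' => absurd h' hA, fun _ => rfl, by rw [map_zero, hg.2 A hA]⟩
  choose f hf using h1
  exact ⟨f, ⟨fun A => (hf A).1, fun A => (hf A).2.1⟩, funext fun A => (hf A).2.2⟩

theorem mem_left_iff {f : Finset ι → M} (hf : f ∈ koszulChains gr i j) :
    b.compLeft (Finset ι) f = 0 ↔ f ∈ koszulChains gr' i j := by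
  constructor
  · intro h0
    exact ⟨fun A hA => (h.ker _ _ (hf.1 A hA)).1 (congrFun h0 A), hf.2⟩
  · intro h0
    ext A
    by_cases hA : A.card = i
    · exact (h.ker _ _ (hf.1 A hA)).2 (h0.1 A hA)
    · rw [LinearMap.compLeft_apply, Function.comp_apply, h0.2 A hA, map_zero]
      rfl

theorem map_eq_zero {f : Finset ι → M} (hf : f ∈ koszulChains gr' i j) :
    b.compLeft (Finset ι) f = 0 :=
  (h.mem_left_iff (koszulChains_mono h.le i j hf)).2 hf

/-- Dimension shifting in Koszul homology along an acyclic module. -/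
theorem dimension_shift (hi : i ≠ 0)
    (hac : ∀ i, i ≠ 0 → koszulCycles x gr i j ≤ koszulBoundaries x gr i j) :
    Nonempty (KoszulHomology y gr'' (i + 1) j ≃ₗ[K] KoszulHomology x gr' i j) := by
  -- `R` consists of the chains of the middle module whose differential lies in `gr'`. It realizes
  -- the connecting map: `f` goes to its image under `b` on one side and to its differential on the
  -- other.
  let R : Submodule K (Finset ι → M) := koszulChains gr (i + 1) j ⊓
    LinearMap.ker ((koszulD y).comp (b.compLeft (Finset ι)))
  refine subquotient_equiv ((b.compLeft (Finset ι)).comp R.subtype)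
    ((koszulD x).comp R.subtype) ?_ ?_ ?_ ?_ ?_
  · rintro ⟨f, hf, hf'⟩
    exact ⟨h.map_chains hf, hf'⟩
  · rintro ⟨f, hf, hf'⟩
    refine ⟨(h.mem_left_iff (h.mid.koszulD_mem hf)).1 ?_, koszulD_koszulD h.mid.comm f⟩
    exact (h.map_koszulD hf).trans hf'
  · rintro z ⟨hz, hz'⟩
    obtain ⟨f, hf, rfl⟩ := h.lift_chains hz
    refine ⟨⟨f, hf, hz'⟩, ?_⟩
    simp
  · rintro z ⟨hz, hz'⟩
    obtain ⟨f, hf, rfl⟩ := hac i hi ⟨koszulChains_mono h.le i j hz, hz'⟩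
    refine ⟨⟨f, hf, ?_⟩, ?_⟩
    · exact (h.map_koszulD hf).symm.trans (h.map_eq_zero hz)
    · simp
  · rintro ⟨f, hf, hf'⟩
    simp only [LinearMap.comp_apply, Submodule.subtype_apply]
    constructor
    · rintro ⟨g, hg, hgf⟩
      obtain ⟨g, hg₀, rfl⟩ := h.lift_chains hg
      refine ⟨f - koszulD x g, ?_, ?_⟩
      · refine (h.mem_left_iff (Submodule.sub_mem _ hf (h.mid.koszulD_mem hg₀))).1 ?_
        rw [map_sub, h.map_koszulD hg₀, hgf, sub_self]
      · rw [map_sub, koszulD_koszulD h.mid.comm, sub_zero]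
    · rintro ⟨f', hf1, hf2⟩
      obtain ⟨g, hg, hgf⟩ := hac (i + 1) (Nat.succ_ne_zero i) (x := f - f')
        ⟨Submodule.sub_mem _ hf (koszulChains_mono h.le _ _ hf1), by
          change koszulD x (f - f') = 0
          rw [map_sub, hf2, sub_self]⟩
      refine ⟨b.compLeft (Finset ι) g, h.map_chains hg, ?_⟩
      rw [← h.map_koszulD hg, hgf, map_sub, h.map_eq_zero hf1, sub_zero]

/-- Additivity of the dimensions of Koszul homology when the connecting maps vanish. -/
theorem finite_finrank_add
    (h₁ : koszulCycles y gr'' (i + 1) j ≤ koszulBoundaries y gr'' (i + 1) j ∨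
      koszulCycles x gr' i j ≤ koszulBoundaries x gr' i j)
    (h₂ : koszulCycles y gr'' i j ≤ koszulBoundaries y gr'' i j ∨ i = 0 ∨
      ∃ i', i = i' + 1 ∧ koszulCycles x gr' i' j ≤ koszulBoundaries x gr' i' j)
    (h' : Module.Finite K (KoszulHomology x gr' i j))
    (h'' : Module.Finite K (KoszulHomology y gr'' i j)) :
    Module.Finite K (KoszulHomology x gr i j) ∧ Module.finrank K (KoszulHomology x gr i j) =
      Module.finrank K (KoszulHomology x gr' i j) +
        Module.finrank K (KoszulHomology y gr'' i j) := by
  refine finite_finrank_subquotient (b.compLeft (Finset ι)) ?_ ?_ ?_ ?_ ?_ ?_ ?_ ?_ h' h''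
  · exact inf_le_inf (koszulChains_mono h.le i j) le_rfl
  · exact Submodule.map_mono (koszulChains_mono h.le (i + 1) j)
  · rintro z ⟨hz, hz'⟩
    refine ⟨h.map_chains hz, ?_⟩
    change koszulD y _ = 0
    rw [← h.map_koszulD hz, LinearMap.mem_ker.1 hz', map_zero]
  · rintro _ ⟨f, hf, rfl⟩
    exact ⟨_, h.map_chains hf, (h.map_koszulD hf).symm⟩
  · rintro z hz ⟨w, hw, rfl⟩
    -- The connecting map out of homological degree `i + 1` vanishes because its source or its
    -- target does; this gives injectivity on the left.
    rcases h₁ with h₁ | h₁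
    · obtain ⟨g, hg, hgw⟩ := h₁ (x := b.compLeft (Finset ι) w) ⟨h.map_chains hw, by
        change koszulD y _ = 0
        rw [← h.map_koszulD hw, h.map_eq_zero hz.1]⟩
      obtain ⟨g, hg₀, rfl⟩ := h.lift_chains hg
      refine ⟨w - koszulD x g, ?_, ?_⟩
      · refine (h.mem_left_iff (Submodule.sub_mem _ hw (h.mid.koszulD_mem hg₀))).1 ?_
        rw [map_sub, h.map_koszulD hg₀, hgw, sub_self]
      · rw [map_sub, koszulD_koszulD h.mid.comm, sub_zero]
    · exact h₁ hz
  · rintro z ⟨hz, hz'⟩ ⟨g, hg, hgz⟩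
    obtain ⟨g, hg₀, rfl⟩ := h.lift_chains hg
    refine ⟨z - koszulD x g, ⟨?_, ?_⟩, ?_⟩
    · refine (h.mem_left_iff (Submodule.sub_mem _ hz (h.mid.koszulD_mem hg₀))).1 ?_
      rw [map_sub, h.map_koszulD hg₀, hgz, sub_self]
    · change koszulD x _ = 0
      rw [map_sub, koszulD_koszulD h.mid.comm, sub_zero,
        LinearMap.mem_ker.1 hz']
    · rw [sub_sub_cancel]
      exact ⟨g, hg₀, rfl⟩
  · intro z hz
    exact h.map_eq_zero hz.1
  · rintro z ⟨hz, hz'⟩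
    -- A class of the quotient lifts because the connecting map out of degree `i` vanishes: its
    -- source is zero, or `i = 0` and there is no target, or its target is zero.
    rcases h₂ with h₂ | rfl | ⟨i, rfl, h₂⟩
    · refine ⟨0, Submodule.zero_mem _, ?_⟩
      rw [map_zero, sub_zero]
      exact h₂ ⟨hz, hz'⟩
    · obtain ⟨f, hf, rfl⟩ := h.lift_chains hz
      refine ⟨f, ⟨hf, koszulD_chains_zero hf⟩, ?_⟩
      rw [sub_self]
      exact Submodule.zero_mem _
    · obtain ⟨f, hf, rfl⟩ := h.lift_chains hz
      obtain ⟨w, hw, hwf⟩ := h₂ (x := koszulD x f) ⟨(h.mem_left_iff (h.mid.koszulD_mem hf)).1 (by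
        rw [h.map_koszulD hf]
        exact hz'), koszulD_koszulD h.mid.comm f⟩
      refine ⟨f - w, ⟨Submodule.sub_mem _ hf (koszulChains_mono h.le _ _ hw), ?_⟩, ?_⟩
      · change koszulD x _ = 0
        rw [map_sub, hwf, sub_self]
      · rw [map_sub, h.map_eq_zero hw, sub_zero, sub_self]
        exact Submodule.zero_mem _

end IsKoszulExact

end KoszulExact

/-! ### Graded free modules over the polynomial ring and their Koszul complexes -/

section Polynomials

variable {n : ℕ} {K : Type*} [Field K]

/-- Multiplication by the variable `X k`. -/
noncomputable def varAct (n : ℕ) (K : Type*) [Field K] (M : Type*) [AddCommGroup M] [Module K M]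
    [Module (MvPolynomial (Fin n) K) M] [IsScalarTower K (MvPolynomial (Fin n) K) M] (k : Fin n) :
    Module.End K M :=
  Algebra.lsmul K K M (X k : MvPolynomial (Fin n) K)

theorem varAct_apply {M : Type*} [AddCommGroup M] [Module K M]
    [Module (MvPolynomial (Fin n) K) M] [IsScalarTower K (MvPolynomial (Fin n) K) M] (k : Fin n)
    (m : M) : varAct n K M k m = (X k : MvPolynomial (Fin n) K) • m := rfl

theorem varAct_comm {M : Type*} [AddCommGroup M] [Module K M]
    [Module (MvPolynomial (Fin n) K) M] [IsScalarTower K (MvPolynomial (Fin n) K) M] (k l : Fin n)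
    (m : M) : varAct n K M k (varAct n K M l m) = varAct n K M l (varAct n K M k m) := by
  simp only [varAct_apply, smul_smul, mul_comm]

/-- Division by the monomial `x^u`, as a linear map. -/
noncomputable def divMap (u : Fin n →₀ ℕ) :
    MvPolynomial (Fin n) K →ₗ[K] MvPolynomial (Fin n) K where
  toFun f := f.divMonomial u
  map_add' f g := by
    ext m
    simp only [coeff_divMonomial, coeff_add]
  map_smul' c f := by
    ext m
    simp only [coeff_divMonomial, coeff_smul, RingHom.id_apply]

theorem coeff_divMap (u m : Fin n →₀ ℕ) (f : MvPolynomial (Fin n) K) :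
    coeff m (divMap u f) = coeff (u + m) f := coeff_divMonomial _ _ _

theorem divMap_comm (u v : Fin n →₀ ℕ) (f : MvPolynomial (Fin n) K) :
    divMap u (divMap v f) = divMap v (divMap u f) := by
  ext m
  simp only [coeff_divMap]
  rw [add_left_comm]

theorem divMap_X_mul_self (k : Fin n) (f : MvPolynomial (Fin n) K) :
    divMap (Finsupp.single k 1) (X k * f) = f := by
  ext m
  rw [coeff_divMap, coeff_X_mul]

theorem divMap_X_mul {k l : Fin n} (h : l ≠ k) (f : MvPolynomial (Fin n) K) :
    divMap (Finsupp.single k 1) (X l * f) = X l * divMap (Finsupp.single k 1) f := by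
  ext m
  rw [coeff_divMap, coeff_X_mul', coeff_X_mul', coeff_divMap]
  have h1 : l ∈ (Finsupp.single k 1 + m).support ↔ l ∈ m.support := by
    simp [h.symm]
  by_cases hl : l ∈ m.support
  · rw [if_pos (h1.2 hl), if_pos hl]
    congr 1
    ext a
    simp only [Finsupp.coe_tsub, Finsupp.coe_add, Pi.sub_apply, Pi.add_apply,
      Finsupp.single_apply]
    have : m l ≠ 0 := Finsupp.mem_support_iff.1 hl
    split_ifs with h2 h3 h3
    · exact absurd (h3.trans h2.symm) h
    · omega
    · subst h3
      omega
    · omega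
  · rw [if_neg (h1.not.2 hl), if_neg hl]

variable {B B' : Type*}

/-- The degree `j` component of `⨁_b S(-deg b)`. -/
def freeGr (deg : B → ℤ) (j : ℤ) : Submodule K (B →₀ MvPolynomial (Fin n) K) where
  carrier := {x | HomogeneousOfDegree deg x j}
  add_mem' := fun {x y} hx hy b m hm => by
    rcases Finset.mem_union.1 (support_add hm) with h | h
    · exact hx b m h
    · exact hy b m h
  zero_mem' := fun b m hm => by simp at hm
  smul_mem' := fun c x hx b m hm => hx b m (support_smul hm)

theorem mem_freeGr {deg : B → ℤ} {j : ℤ} {x : B →₀ MvPolynomial (Fin n) K} :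
    x ∈ freeGr deg j ↔ HomogeneousOfDegree deg x j := Iff.rfl

/-- The degree `j` component of `S`. -/
def polyGr (j : ℤ) : Submodule K (MvPolynomial (Fin n) K) where
  carrier := {x | ∀ m ∈ x.support, (m.degree : ℤ) = j}
  add_mem' := fun {x y} hx hy m hm => by
    rcases Finset.mem_union.1 (support_add hm) with h | h
    · exact hx m h
    · exact hy m h
  zero_mem' := fun m hm => by simp at hm
  smul_mem' := fun c x hx m hm => hx m (support_smul hm)

theorem X_mul_mem_polyGr (k : Fin n) {j : ℤ} {x : MvPolynomial (Fin n) K} (hx : x ∈ polyGr j) :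
    X k * x ∈ polyGr (j + 1) := by
  intro m hm
  rw [support_X_mul, Finset.mem_map] at hm
  obtain ⟨m', hm', rfl⟩ := hm
  have := hx m' hm'
  simp only [addLeftEmbedding_apply, map_add, Finsupp.degree_single]
  push_cast
  omega

theorem divMap_mem_polyGr (u : Fin n →₀ ℕ) {j : ℤ} {x : MvPolynomial (Fin n) K}
    (hx : x ∈ polyGr j) : divMap u x ∈ polyGr (j - u.degree) := by
  intro m hm
  rw [mem_support_iff, coeff_divMap] at hm
  have := hx _ (mem_support_iff.2 hm)
  rw [map_add] at this
  push_cast at this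
  omega

theorem mem_freeGr_iff {deg : B → ℤ} {j : ℤ} {x : B →₀ MvPolynomial (Fin n) K} :
    x ∈ freeGr deg j ↔ ∀ b, x b ∈ polyGr (j - deg b) := by
  refine forall_congr' fun b => forall_congr' fun m => forall_congr' fun _ => ?_
  omega

theorem isGradedFor_freeGr (deg : B → ℤ) :
    IsGradedFor (varAct n K (B →₀ MvPolynomial (Fin n) K)) (freeGr deg) where
  comm := varAct_comm
  act k j x hx := by
    rw [mem_freeGr_iff] at hx ⊢
    intro b
    have := X_mul_mem_polyGr k (hx b)
    rwa [show j - deg b + 1 = j + 1 - deg b by ring] at this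

/-- The reduction of a free module modulo the variables. -/
noncomputable def constTerm : (B →₀ MvPolynomial (Fin n) K) →ₗ[K] (B →₀ K) where
  toFun x := x.mapRange constantCoeff (map_zero _)
  map_add' x y := by
    ext
    simp
  map_smul' c x := by
    ext
    simp [constantCoeff_eq]

theorem constTerm_apply (x : B →₀ MvPolynomial (Fin n) K) (b : B) :
    constTerm x b = coeff 0 (x b) := by
  simp [constTerm, constantCoeff_eq]

theorem constTerm_varAct (k : Fin n) (x : B →₀ MvPolynomial (Fin n) K) :
    constTerm (varAct n K _ k x) = 0 := by
  ext b
  rw [constTerm_apply, varAct_apply, Finsupp.smul_apply, smul_eq_mul, coeff_X_mul']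
  simp

theorem constTerm_koszulD (f : Finset (Fin n) → B →₀ MvPolynomial (Fin n) K)
    (A : Finset (Fin n)) : constTerm (koszulD (varAct n K _) f A) = 0 := by
  rw [koszulD_apply, map_sum]
  refine Finset.sum_eq_zero fun k _ => ?_
  rw [map_smul, constTerm_varAct, smul_zero]

/-- The lift of a vector to a vector with constant entries. -/
noncomputable def constLift : (B →₀ K) →ₗ[K] (B →₀ MvPolynomial (Fin n) K) :=
  Finsupp.mapRange.linearMap (Algebra.linearMap K (MvPolynomial (Fin n) K))

theorem constLift_apply (x : B →₀ K) (b : B) :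
    (constLift x : B →₀ MvPolynomial (Fin n) K) b = C (x b) := by
  simp [constLift, algebraMap_eq]

theorem constTerm_constLift (x : B →₀ K) :
    constTerm (constLift x : B →₀ MvPolynomial (Fin n) K) = x := by
  ext b
  rw [constTerm_apply, constLift_apply, coeff_zero_C]

theorem constLift_mem {deg : B → ℤ} {j : ℤ} {x : B →₀ K}
    (hx : x ∈ Finsupp.supported K K {b | deg b = j}) :
    (constLift x : B →₀ MvPolynomial (Fin n) K) ∈ freeGr deg j := by
  classical
  intro b m hm
  rw [constLift_apply, mem_support_iff, coeff_C] at hm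
  split_ifs at hm with h0
  · have : deg b = j := hx (Finsupp.mem_support_iff.2 hm)
    simp [← h0, this]
  · exact absurd rfl hm

theorem constTerm_mem {deg : B → ℤ} {j : ℤ} {x : B →₀ MvPolynomial (Fin n) K}
    (hx : x ∈ freeGr deg j) : constTerm x ∈ Finsupp.supported K K {b | deg b = j} := by
  intro b hb
  have h1 : constTerm x b ≠ 0 := Finsupp.mem_support_iff.1 hb
  rw [constTerm_apply] at h1
  have := hx b 0 (mem_support_iff.2 h1)
  simpa using this

/-- The Koszul complex of a free module is exact, except for the constant terms. -/
theorem mem_koszulBoundaries_free {deg : B → ℤ} {i : ℕ} {j : ℤ}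
    {z : Finset (Fin n) → B →₀ MvPolynomial (Fin n) K}
    (hz : z ∈ koszulCycles (varAct n K _) (freeGr deg) i j) (h0 : constTerm (z ∅) = 0) :
    z ∈ koszulBoundaries (varAct n K _) (freeGr deg) i j := by
  refine mem_koszulBoundaries_of_division (isGradedFor_freeGr deg) Finset.univ
    (fun k => Finsupp.mapRange.linearMap (divMap (Finsupp.single k 1))) ?_ ?_ ?_ ?_ constTerm
    constTerm_varAct ?_ hz ?_
  · intro k _ m
    ext1 b
    simp [varAct_apply, divMap_X_mul_self]
  · intro k _ l hl m
    ext1 b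
    simp [varAct_apply, divMap_X_mul hl]
  · intro k _ l _ m
    ext1 b
    simp only [Finsupp.mapRange.linearMap_apply, Finsupp.mapRange_apply]
    exact divMap_comm _ _ _
  · intro k _ j m hm
    rw [mem_freeGr_iff] at hm ⊢
    intro b
    have := divMap_mem_polyGr (Finsupp.single k 1) (hm b)
    rw [Finsupp.degree_single, show j - deg b - (1 : ℕ) = j - 1 - deg b by push_cast; ring] at this
    simpa using this
  -- Every monomial other than 1 is divisible by some variable, so its coefficient is seen by one of
  -- the divisions; the monomial 1 is seen by the constant term.
  · intro j x _ h1 h2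
    ext b m
    rcases eq_or_ne m 0 with rfl | hm
    · have := DFunLike.congr_fun h2 b
      rw [constTerm_apply] at this
      simpa using this
    · obtain ⟨k, hk⟩ := Finsupp.ne_iff.1 hm
      have h3 := DFunLike.congr_fun (h1 k (Finset.mem_univ k)) b
      have h4 := congrArg (coeff (m - Finsupp.single k 1)) h3
      simp only [Finsupp.mapRange.linearMap_apply, Finsupp.mapRange_apply, coeff_divMap] at h4
      rw [add_tsub_cancel_of_le] at h4
      · simpa using h4
      · rw [Finsupp.single_le_iff]
        exact Nat.one_le_iff_ne_zero.2 hk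
  · intro A hA
    rwa [Finset.eq_empty_of_forall_notMem fun k hk =>
      Finset.disjoint_left.1 hA hk (Finset.mem_univ k)]

/-- A chain of positive homological degree vanishes at `∅`, the only place where a constant term
obstructs. -/
theorem koszulCycles_free_le {deg : B → ℤ} {i : ℕ} (hi : i ≠ 0) (j : ℤ) :
    koszulCycles (varAct n K (B →₀ MvPolynomial (Fin n) K)) (freeGr deg) i j ≤
      koszulBoundaries (varAct n K _) (freeGr deg) i j := fun z hz =>
  mem_koszulBoundaries_free hz (by rw [hz.1.2 ∅ (by simpa using hi.symm), map_zero])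

theorem map_homogeneous {deg : B → ℤ} {deg' : B' → ℤ}
    {φ : (B →₀ MvPolynomial (Fin n) K) →ₗ[MvPolynomial (Fin n) K] (B' →₀ MvPolynomial (Fin n) K)}
    (hφ : ∀ b, HomogeneousOfDegree deg' (φ (Finsupp.single b 1)) (deg b)) {j : ℤ}
    {x : B →₀ MvPolynomial (Fin n) K} (hx : x ∈ freeGr deg j) : φ x ∈ freeGr deg' j := by
  classical
  have h1 : φ x = ∑ b ∈ x.support, x b • φ (Finsupp.single b 1) := by
    conv_lhs => rw [← Finsupp.sum_single x, Finsupp.sum, map_sum]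
    refine Finset.sum_congr rfl fun b _ => ?_
    rw [← map_smul, Finsupp.smul_single, smul_eq_mul, mul_one]
  rw [h1]
  refine Submodule.sum_mem _ fun b _ b' m hm => ?_
  rw [Finsupp.smul_apply, smul_eq_mul] at hm
  obtain ⟨m₁, h₁, m₂, h₂, rfl⟩ := Finset.mem_add.1 (support_mul _ _ hm)
  have h3 := hx b m₁ h₁
  have h4 := hφ b b' m₂ h₂
  rw [map_add]
  push_cast
  omega

/-- The degree `j` part of any preimage works, since `φ` is homogeneous of degree zero. It is built
by linearity: each term of `y` is kept or dropped according to its degree. -/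
theorem exists_homogeneous_preimage {deg : B → ℤ} {deg' : B' → ℤ}
    {φ : (B →₀ MvPolynomial (Fin n) K) →ₗ[MvPolynomial (Fin n) K] (B' →₀ MvPolynomial (Fin n) K)}
    (hφ : ∀ b, HomogeneousOfDegree deg' (φ (Finsupp.single b 1)) (deg b)) {j : ℤ}
    (y : B →₀ MvPolynomial (Fin n) K) (hy : φ y ∈ freeGr deg' j) :
    ∃ x ∈ freeGr deg j, φ x = φ y := by
  classical
  have key : ∀ y : B →₀ MvPolynomial (Fin n) K, ∃ x ∈ freeGr deg j, ∀ b m,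
      coeff m (φ x b) = if (m.degree : ℤ) + deg' b = j then coeff m (φ y b) else 0 := by
    intro y
    induction y using Finsupp.induction_linear with
    | zero => exact ⟨0, Submodule.zero_mem _, by simp⟩
    | add y y' h h' =>
      obtain ⟨x, hx, h⟩ := h
      obtain ⟨x', hx', h'⟩ := h'
      refine ⟨x + x', Submodule.add_mem _ hx hx', fun b m => ?_⟩
      simp only [map_add, Finsupp.add_apply, coeff_add, h, h']
      split_ifs <;> simp
    | single b p =>
      induction p using MvPolynomial.induction_on' with
      | add p q h h' =>
        obtain ⟨x, hx, h⟩ := h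
        obtain ⟨x', hx', h'⟩ := h'
        refine ⟨x + x', Submodule.add_mem _ hx hx', fun b m => ?_⟩
        simp only [map_add, Finsupp.add_apply, coeff_add, h, h', Finsupp.single_add]
        split_ifs <;> simp
      | monomial u c =>
        have h1 : (Finsupp.single b (monomial u c) : B →₀ MvPolynomial (Fin n) K) ∈
            freeGr deg (u.degree + deg b) := by
          intro b' m hm
          rw [Finsupp.single_apply] at hm
          split_ifs at hm with h
          · subst h
            rw [Finset.mem_singleton.1 (support_monomial_subset hm)]
          · simp at hm
        have h2 := map_homogeneous hφ h1
        by_cases hj : (u.degree : ℤ) + deg b = j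
        · refine ⟨_, hj ▸ h1, fun b' m => ?_⟩
          split_ifs with h3
          · rfl
          · by_contra h4
            exact h3 (hj ▸ h2 b' m (mem_support_iff.2 h4))
        · refine ⟨0, Submodule.zero_mem _, fun b' m => ?_⟩
          split_ifs with h3
          · by_contra h4
            exact hj ((h2 b' m (mem_support_iff.2 fun h5 => h4 (by simp [h5]))).symm.trans h3)
          · simp
  obtain ⟨x, hx, h⟩ := key y
  refine ⟨x, hx, ?_⟩
  ext b m
  rw [h]
  split_ifs with h1
  · rfl
  · by_contra h2
    exact h1 (hy b m (mem_support_iff.2 (Ne.symm h2)))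

/-- The grading of a submodule of a graded free module. -/
noncomputable def subGr (deg : B → ℤ) (N : Submodule (MvPolynomial (Fin n) K) (B →₀ MvPolynomial (Fin n) K))
    (j : ℤ) : Submodule K (B →₀ MvPolynomial (Fin n) K) := N.restrictScalars K ⊓ freeGr deg j

/-- The grading of an ideal. -/
noncomputable def idealGr (I : Ideal (MvPolynomial (Fin n) K)) (j : ℤ) : Submodule K (MvPolynomial (Fin n) K) :=
  I.restrictScalars K ⊓ polyGr j

theorem isGradedFor_idealGr (I : Ideal (MvPolynomial (Fin n) K)) :
    IsGradedFor (varAct n K _) (idealGr I) where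
  comm := varAct_comm
  act k _ _ hx := ⟨I.smul_mem _ hx.1, X_mul_mem_polyGr k hx.2⟩

end Polynomials

/-! ### Koszul chains of homological degree zero -/

section Point

variable {ι : Type*} [LinearOrder ι] [Fintype ι] {K : Type*} [Field K] {M N : Type*}
  [AddCommGroup M] [Module K M] [AddCommGroup N] [Module K N]

/-- The Koszul chain of homological degree zero with value `m`. -/
def koszulPoint (ι K : Type*) [LinearOrder ι] [Field K] {M : Type*} [AddCommGroup M] [Module K M] :
    M →ₗ[K] (Finset ι → M) := LinearMap.single K (fun _ : Finset ι => M) ∅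

theorem koszulPoint_empty (m : M) : koszulPoint ι K m ∅ = m :=
  Pi.single_eq_same (M := fun _ : Finset ι => M) ∅ m

theorem koszulPoint_of_ne (m : M) {A : Finset ι} (hA : A ≠ ∅) : koszulPoint ι K m A = 0 :=
  Pi.single_eq_of_ne hA _

theorem koszulPoint_mem {gr : ℤ → Submodule K M} {j : ℤ} {m : M} (hm : m ∈ gr j) :
    koszulPoint ι K m ∈ koszulChains gr 0 j := by
  refine ⟨fun A hA => ?_, fun A hA => koszulPoint_of_ne m (by simpa using hA)⟩
  rw [Finset.card_eq_zero.1 hA, koszulPoint_empty]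
  simpa using hm

theorem koszulPoint_mem_cycles {x : ι → Module.End K M} {gr : ℤ → Submodule K M} {j : ℤ} {m : M}
    (hm : m ∈ gr j) : koszulPoint ι K m ∈ koszulCycles x gr 0 j :=
  ⟨koszulPoint_mem hm, koszulD_chains_zero (koszulPoint_mem hm)⟩

theorem eq_koszulPoint {gr : ℤ → Submodule K M} {j : ℤ} {f : Finset ι → M}
    (hf : f ∈ koszulChains gr 0 j) : f = koszulPoint ι K (f ∅) := by
  ext A
  by_cases hA : A = ∅
  · rw [hA, koszulPoint_empty]
  · rw [koszulPoint_of_ne _ hA, hf.2 A (by simpa using hA)]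

theorem apply_empty_mem {gr : ℤ → Submodule K M} {j : ℤ} {f : Finset ι → M}
    (hf : f ∈ koszulChains gr 0 j) : f ∅ ∈ gr j := by
  simpa using hf.1 ∅ rfl

theorem compLeft_koszulPoint (b : M →ₗ[K] N) (m : M) :
    b.compLeft (Finset ι) (koszulPoint ι K m) = koszulPoint ι K (b m) := by
  ext A
  by_cases hA : A = ∅
  · simp [hA, koszulPoint_empty]
  · simp [koszulPoint_of_ne _ hA]

end Point

/-! ### Tor as Koszul homology -/

section TorComparison

universe u v

variable {n : ℕ} {K : Type u} [Field K] {I : Ideal (MvPolynomial (Fin n) K)}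

namespace GradedFreeResolution

variable (F : GradedFreeResolution.{u, v} I)

/-- The `i`-th differential as a `K`-linear map. -/
noncomputable def dK (i : ℕ) : (F.basis (i + 1) →₀ MvPolynomial (Fin n) K) →ₗ[K]
    (F.basis i →₀ MvPolynomial (Fin n) K) := (F.d i).restrictScalars K

/-- The augmentation as a `K`-linear map to the polynomial ring. -/
noncomputable def augK : (F.basis 0 →₀ MvPolynomial (Fin n) K) →ₗ[K] MvPolynomial (Fin n) K :=
  (I.subtype ∘ₗ F.aug).restrictScalars K

theorem dK_dK (i : ℕ) (x) : F.dK i (F.dK (i + 1) x) = 0 := (F.exact_succ i).apply_apply_eq_zero x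

theorem augK_dK (x) : F.augK (F.dK 0 x) = 0 :=
  congrArg Subtype.val (F.exact_zero.apply_apply_eq_zero x)

theorem augK_eq_zero_iff (x) : F.augK x = 0 ↔ x ∈ LinearMap.range (F.d 0) :=
  Iff.trans (ZeroMemClass.coe_eq_zero (S' := I) (x := F.aug x)) (F.exact_zero x)

theorem dK_mem (i : ℕ) {j : ℤ} {x : F.basis (i + 1) →₀ MvPolynomial (Fin n) K}
    (hx : x ∈ freeGr (F.deg (i + 1)) j) : F.dK i x ∈ freeGr (F.deg i) j :=
  map_homogeneous (F.d_homogeneous i) hx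

theorem exists_dK_eq (i : ℕ) {j : ℤ} {x : F.basis i →₀ MvPolynomial (Fin n) K}
    (hx : x ∈ subGr (F.deg i) (LinearMap.range (F.d i)) j) :
    ∃ y ∈ freeGr (F.deg (i + 1)) j, F.dK i y = x := by
  obtain ⟨⟨y, rfl⟩, hy⟩ := hx
  exact exists_homogeneous_preimage (F.d_homogeneous i) y hy

theorem constTerm_dK (i : ℕ) (x : F.basis (i + 1) →₀ MvPolynomial (Fin n) K) :
    constTerm (F.dK i x) = F.tensorD i (constTerm x) := (F.tensorD_mapRange i x).symm

/-- Along these sequences, with a free middle term, the syzygies are peeled off by dimension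
shifting. -/
theorem isKoszulExact_d (i : ℕ) : IsKoszulExact (varAct n K _) (varAct n K _)
    (subGr (F.deg (i + 1)) (LinearMap.range (F.d (i + 1)))) (freeGr (F.deg (i + 1)))
    (subGr (F.deg i) (LinearMap.range (F.d i))) (F.dK i) where
  mid := isGradedFor_freeGr _
  le _ := inf_le_right
  equivariant k _ m _ := (F.d i).map_smul (X k) m
  map _ m hm := ⟨⟨m, rfl⟩, F.dK_mem i hm⟩
  surj _ _ hq := F.exists_dK_eq i hq
  ker _ m hm := ⟨fun h => ⟨(F.exact_succ i m).1 h, hm⟩, fun h => (F.exact_succ i m).2 h.1⟩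

/-- The augmentation with values in a free module of rank one. -/
noncomputable def augFree : (F.basis 0 →₀ MvPolynomial (Fin n) K) →ₗ[MvPolynomial (Fin n) K]
    (Unit →₀ MvPolynomial (Fin n) K) := Finsupp.lsingle () ∘ₗ I.subtype ∘ₗ F.aug

theorem augFree_apply (x) : F.augFree x = Finsupp.single () (F.augK x) := rfl

theorem single_mem_freeGr {j : ℤ} {f : MvPolynomial (Fin n) K} :
    (Finsupp.single () f : Unit →₀ _) ∈ freeGr (fun _ => 0) j ↔ f ∈ polyGr j := by
  rw [mem_freeGr_iff]
  simp

theorem augFree_homogeneous (b) :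
    HomogeneousOfDegree (fun _ => 0) (F.augFree (Finsupp.single b 1)) (F.deg 0 b) := by
  rw [augFree_apply, ← mem_freeGr, single_mem_freeGr]
  exact F.aug_homogeneous b

theorem isKoszulExact_aug : IsKoszulExact (varAct n K _) (varAct n K _)
    (subGr (F.deg 0) (LinearMap.range (F.d 0))) (freeGr (F.deg 0)) (idealGr I) F.augK where
  mid := isGradedFor_freeGr _
  le _ := inf_le_right
  equivariant k _ m _ := (I.subtype ∘ₗ F.aug).map_smul (X k) m
  map _ m hm := ⟨(F.aug m).2, single_mem_freeGr.1 (map_homogeneous F.augFree_homogeneous hm)⟩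
  surj j q hq := by
    obtain ⟨x, hx⟩ := F.aug_surjective ⟨q, hq.1⟩
    have hx' : F.augK x = q := congrArg Subtype.val hx
    obtain ⟨y, hy, hyx⟩ := exists_homogeneous_preimage (j := j) F.augFree_homogeneous x (by
      rw [augFree_apply, single_mem_freeGr, hx']
      exact hq.2)
    refine ⟨y, hy, ?_⟩
    rw [augFree_apply, augFree_apply] at hyx
    rw [← hx']
    exact Finsupp.single_injective () hyx
  ker _ m hm := ⟨fun h => ⟨(F.augK_eq_zero_iff m).1 h, hm⟩, fun h => (F.augK_eq_zero_iff m).2 h.1⟩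

/-- If `F_i` resolves `gr''`, then the homology of `F ⊗ K` at `i + 1` is the first Koszul homology
of `gr''`. -/
theorem nonempty_koszulHomology_one_equiv (i : ℕ) (j : ℤ) {N : Type*} [AddCommGroup N] [Module K N]
    {y : Fin n → Module.End K N} {gr'' : ℤ → Submodule K N}
    {b : (F.basis i →₀ MvPolynomial (Fin n) K) →ₗ[K] N}
    (h : IsKoszulExact (varAct n K _) y (subGr (F.deg i) (LinearMap.range (F.d i)))
      (freeGr (F.deg i)) gr'' b) :
    Nonempty (KoszulHomology y gr'' 1 j ≃ₗ[K] F.Tor (i + 1) j) := by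
  have hbd : ∀ w ∈ freeGr (F.deg (i + 1)) j, b (F.dK i w) = 0 := fun w hw =>
    (h.ker _ _ (F.dK_mem i hw)).2 ⟨⟨w, rfl⟩, F.dK_mem i hw⟩
  -- `R` consists of pairs of a Koszul 1-chain `f` over `F_i` and an element `w` of `F_{i+1}` whose
  -- differentials agree in `F_i`. Then `b` maps `f` to a Koszul cycle of `gr''`, and `w` reduces to
  -- a cycle of `F ⊗ K` because a Koszul boundary has no constant term.
  let R : Submodule K ((Finset (Fin n) → F.basis i →₀ MvPolynomial (Fin n) K) ×
      (F.basis (i + 1) →₀ MvPolynomial (Fin n) K)) :=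
    ((koszulChains (freeGr (F.deg i)) 1 j).prod (freeGr (F.deg (i + 1)) j)) ⊓
      LinearMap.ker (LinearMap.coprod (koszulD (varAct n K _))
        (-(koszulPoint (Fin n) K ∘ₗ F.dK i)))
  have hR : ∀ r : R, koszulD (varAct n K _) r.1.1 = koszulPoint (Fin n) K (F.dK i r.1.2) := by
    intro r
    have := LinearMap.mem_ker.1 r.2.2
    rw [LinearMap.coprod_apply, LinearMap.neg_apply, ← sub_eq_add_neg, sub_eq_zero] at this
    exact this
  have mkR : ∀ f ∈ koszulChains (freeGr (F.deg i)) 1 j, ∀ w ∈ freeGr (F.deg (i + 1)) j,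
      koszulD (varAct n K _) f = koszulPoint (Fin n) K (F.dK i w) → (f, w) ∈ R := by
    intro f hf w hw hfw
    refine ⟨⟨hf, hw⟩, LinearMap.mem_ker.2 ?_⟩
    rw [LinearMap.coprod_apply, LinearMap.neg_apply, ← sub_eq_add_neg, sub_eq_zero]
    exact hfw
  refine subquotient_equiv (R := R)
    (b.compLeft (Finset (Fin n)) ∘ₗ LinearMap.fst K _ _ ∘ₗ R.subtype)
    (constTerm (n := n) (K := K) (B := F.basis (i + 1)) ∘ₗ LinearMap.snd K _ _ ∘ₗ R.subtype) ?_ ?_ ?_ ?_ ?_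
  · intro r
    refine ⟨h.map_chains r.2.1.1, LinearMap.mem_ker.2 ?_⟩
    have := h.map_koszulD r.2.1.1
    rw [hR r, compLeft_koszulPoint, hbd _ r.2.1.2, map_zero] at this
    exact this.symm
  · intro r
    refine ⟨constTerm_mem r.2.1.2, LinearMap.mem_ker.2 ?_⟩
    simp only [LinearMap.comp_apply, LinearMap.snd_apply, Submodule.subtype_apply]
    rw [← constTerm_dK, ← koszulPoint_empty (ι := Fin n) (K := K) (F.dK i r.1.2), ← hR r,
      constTerm_koszulD]
  · rintro z ⟨hz, hz'⟩
    obtain ⟨f, hf, rfl⟩ := h.lift_chains hz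
    have h1 : koszulD (varAct n K _) f ∈
        koszulChains (subGr (F.deg i) (LinearMap.range (F.d i))) 0 j :=
      (h.mem_left_iff (h.mid.koszulD_mem hf)).1 ((h.map_koszulD hf).trans hz')
    obtain ⟨w, hw, hwf⟩ := F.exists_dK_eq i (apply_empty_mem h1)
    refine ⟨⟨(f, w), mkR f hf w hw ?_⟩, ?_⟩
    · rw [hwf]
      exact eq_koszulPoint h1
    · simp
  -- As `v` is a cycle, the image of its constant lift has no constant term, hence is a Koszul
  -- boundary; this supplies `f`.
  · rintro v ⟨hv, hv'⟩
    have hw := constLift_mem (n := n) hv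
    obtain ⟨f, hf, hfw⟩ := mem_koszulBoundaries_free
      (koszulPoint_mem_cycles (x := varAct n K _) (F.dK_mem i hw)) (by
        rw [koszulPoint_empty, constTerm_dK, constTerm_constLift]
        exact hv')
    refine ⟨⟨(f, constLift v), mkR f hf _ hw hfw⟩, ?_⟩
    simp [constTerm_constLift]
  · intro r
    have hr := hR r
    obtain ⟨⟨f, w⟩, ⟨hf, hw⟩, hrr⟩ := r
    simp only [LinearMap.comp_apply, Submodule.subtype_apply, LinearMap.fst_apply,
      LinearMap.snd_apply] at hr hf hw ⊢
    constructor
    -- Corrected by a boundary, `f` comes from a chain `f'` over `F_{i+1}`. Then `w` and the Koszul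
    -- differential of `f'` have the same image in `F_i`, so they differ by the image of some `t`,
    -- and the reduction of `t` bounds that of `w`.
    · rintro ⟨g, hg, hgf⟩
      obtain ⟨g, hg', rfl⟩ := h.lift_chains hg
      have h1 : f - koszulD (varAct n K _) g ∈
          koszulChains (subGr (F.deg i) (LinearMap.range (F.d i))) 1 j := by
        refine (h.mem_left_iff (Submodule.sub_mem _ hf (h.mid.koszulD_mem hg'))).1 ?_
        rw [map_sub, h.map_koszulD hg', hgf, sub_self]
      obtain ⟨f', hf', hff'⟩ := (F.isKoszulExact_d i).lift_chains h1
      have h2 := (F.isKoszulExact_d i).map_koszulD hf'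
      rw [hff', map_sub, koszulD_koszulD h.mid.comm, sub_zero, hr] at h2
      have h3 := (F.isKoszulExact_d i).mid.koszulD_mem hf'
      have h4 : F.dK i (w - koszulD (varAct n K _) f' ∅) = 0 := by
        have := congrFun h2 ∅
        rw [koszulPoint_empty, LinearMap.compLeft_apply, Function.comp_apply] at this
        rw [map_sub, this, sub_self]
      have h5 : w - koszulD (varAct n K _) f' ∅ ∈ freeGr (F.deg (i + 1)) j :=
        Submodule.sub_mem _ hw (apply_empty_mem h3)
      obtain ⟨t, ht, htw⟩ := F.exists_dK_eq (i + 1)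
        (((F.isKoszulExact_d i).ker _ _ h5).1 h4)
      refine ⟨constTerm t, constTerm_mem ht, ?_⟩
      rw [← constTerm_dK, htw, map_sub, constTerm_koszulD, sub_zero]
    -- Subtracting the image of the lift of `v` removes the constant term of `w`, so what remains is
    -- the Koszul boundary of some `f'`. Then `f` differs from the image of `f'` by a 1-cycle over
    -- the free module `F_i`, which is a boundary.
    · rintro ⟨v, hv, hvw⟩
      have ht := constLift_mem (n := n) hv
      have h1 : w - F.dK (i + 1) (constLift v) ∈ freeGr (F.deg (i + 1)) j :=
        Submodule.sub_mem _ hw (F.dK_mem _ ht)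
      obtain ⟨f', hf', hff'⟩ := mem_koszulBoundaries_free
        (koszulPoint_mem_cycles (x := varAct n K _) h1) (by
          rw [koszulPoint_empty, map_sub, constTerm_dK, constTerm_constLift, hvw, sub_self])
      have h2 := (F.isKoszulExact_d i).map_koszulD hf'
      rw [hff', compLeft_koszulPoint, map_sub, dK_dK, sub_zero, ← hr] at h2
      have h3 := (F.isKoszulExact_d i).map_chains hf'
      have h4 := koszulChains_mono (fun _ => inf_le_right) 1 j h3
      obtain ⟨g, hg, hgf⟩ := koszulCycles_free_le one_ne_zero j
        (x := f - (F.dK i).compLeft _ f') ⟨Submodule.sub_mem _ hf h4, by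
          change koszulD _ _ = 0
          rw [map_sub, ← h2, sub_self]⟩
      refine ⟨_, h.map_chains hg, ?_⟩
      rw [← h.map_koszulD hg, hgf, map_sub, h.map_eq_zero h3, sub_zero]

/-- Both sides are quotients of the degree `j` part of `F_0`, by what comes from the variables and
from the image of `F_1`. -/
theorem nonempty_koszulHomology_zero_equiv (j : ℤ) :
    Nonempty (KoszulHomology (varAct n K _) (idealGr I) 0 j ≃ₗ[K] F.Tor 0 j) := by
  have h := F.isKoszulExact_aug
  refine subquotient_equiv (R := (freeGr (F.deg 0) j : Submodule K _))
    (koszulPoint (Fin n) K ∘ₗ F.augK ∘ₗ (freeGr (F.deg 0) j).subtype)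
    (constTerm (n := n) (K := K) (B := F.basis 0) ∘ₗ (freeGr (F.deg 0) j).subtype) ?_ ?_ ?_ ?_ ?_
  · exact fun r => koszulPoint_mem_cycles (h.map _ _ r.2)
  · exact fun r => constTerm_mem r.2
  · rintro z ⟨hz, -⟩
    obtain ⟨w, hw, hwz⟩ := h.surj _ _ (apply_empty_mem hz)
    refine ⟨⟨w, hw⟩, ?_⟩
    simp only [LinearMap.comp_apply, Submodule.subtype_apply]
    rw [hwz, ← eq_koszulPoint hz, sub_self]
    exact Submodule.zero_mem _
  · intro v hv
    refine ⟨⟨constLift v, constLift_mem hv⟩, ?_⟩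
    simp [constTerm_constLift]
  · rintro ⟨w, hw⟩
    simp only [LinearMap.comp_apply, Submodule.subtype_apply]
    constructor
    · rintro ⟨g, hg, hgw⟩
      obtain ⟨g, hg', rfl⟩ := h.lift_chains hg
      rw [← h.map_koszulD hg'] at hgw
      have h1 : w - koszulD (varAct n K _) g ∅ ∈ freeGr (F.deg 0) j :=
        Submodule.sub_mem _ hw (apply_empty_mem (h.mid.koszulD_mem hg'))
      have h2 : F.augK (w - koszulD (varAct n K _) g ∅) = 0 := by
        have := congrFun hgw ∅
        rw [koszulPoint_empty, LinearMap.compLeft_apply, Function.comp_apply] at this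
        rw [map_sub, this, sub_self]
      obtain ⟨t, ht, htw⟩ := F.exists_dK_eq 0 ((h.ker _ _ h1).1 h2)
      refine ⟨constTerm t, constTerm_mem ht, ?_⟩
      rw [← constTerm_dK, htw, map_sub, constTerm_koszulD, sub_zero]
    · rintro ⟨v, hv, hvw⟩
      have ht := constLift_mem (n := n) hv
      have h1 : w - F.dK 0 (constLift v) ∈ freeGr (F.deg 0) j :=
        Submodule.sub_mem _ hw (F.dK_mem _ ht)
      obtain ⟨f, hf, hff⟩ := mem_koszulBoundaries_free
        (koszulPoint_mem_cycles (x := varAct n K _) h1) (by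
          rw [koszulPoint_empty, map_sub, constTerm_dK, constTerm_constLift, hvw, sub_self])
      refine ⟨_, h.map_chains hf, ?_⟩
      rw [← h.map_koszulD hf, hff, compLeft_koszulPoint, map_sub, augK_dK, sub_zero]

/-- Free modules are acyclic, so each sequence `isKoszulExact_d` trades one homological degree for
one syzygy step. -/
theorem nonempty_koszulHomology_range_equiv (j : ℤ) (i p : ℕ) :
    Nonempty (KoszulHomology (varAct n K _) (subGr (F.deg 0) (LinearMap.range (F.d 0)))
      (p + 1 + i) j ≃ₗ[K]
      KoszulHomology (varAct n K _) (subGr (F.deg i) (LinearMap.range (F.d i))) (p + 1) j) := by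
  induction i generalizing p with
  | zero => exact ⟨LinearEquiv.refl _ _⟩
  | succ i ih =>
    obtain ⟨e⟩ := ih (p + 1)
    obtain ⟨e'⟩ := (F.isKoszulExact_d i).dimension_shift (j := j) (Nat.succ_ne_zero p)
      (fun i hi => koszulCycles_free_le hi j)
    rw [show p + 1 + (i + 1) = p + 1 + 1 + i by ring]
    exact ⟨e.trans e'⟩

/-- `Tor` can be computed by Koszul homology. -/
theorem nonempty_koszulHomology_equiv_tor (i : ℕ) (j : ℤ) :
    Nonempty (KoszulHomology (varAct n K _) (idealGr I) i j ≃ₗ[K] F.Tor i j) := by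
  match i with
  | 0 => exact F.nonempty_koszulHomology_zero_equiv j
  | 1 => exact F.nonempty_koszulHomology_one_equiv 0 j F.isKoszulExact_aug
  -- The homology of `I` in degree `i + 2` shifts to that of the image of `d 0` in degree `i + 1`,
  -- then to that of the image of `d i` in degree 1, and `F_{i+1}` maps onto this last module.
  | i + 2 =>
    obtain ⟨e⟩ := F.isKoszulExact_aug.dimension_shift (j := j) (Nat.succ_ne_zero i)
      (fun i hi => koszulCycles_free_le hi j)
    have h := F.nonempty_koszulHomology_range_equiv j i 0
    rw [show 0 + 1 + i = i + 1 by ring] at h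
    obtain ⟨e'⟩ := h
    obtain ⟨e''⟩ := F.nonempty_koszulHomology_one_equiv (i + 1) j (F.isKoszulExact_d i)
    exact ⟨e.trans (e'.trans e'')⟩

end GradedFreeResolution

end TorComparison

/-! ### Computing dimensions of subquotients -/

section Subquotients

variable {K : Type*} [Field K] {V W : Type*} [AddCommGroup V] [Module K V] [AddCommGroup W]
  [Module K W] {Z B : Submodule K V}

theorem nonempty_subquotient_equiv (b : V →ₗ[K] W) (hs : ∀ w, ∃ z ∈ Z, b z = w)
    (hk : ∀ z ∈ Z, b z = 0 ↔ z ∈ B) : Nonempty (Subquotient Z B ≃ₗ[K] W) := by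
  have h1 : Function.Surjective (b.domRestrict Z) := fun w => by
    obtain ⟨z, hz, hzw⟩ := hs w
    exact ⟨⟨z, hz⟩, hzw⟩
  have h2 : B.submoduleOf Z = LinearMap.ker (b.domRestrict Z) := by
    ext z
    exact (hk z z.2).symm
  exact ⟨(Submodule.quotEquivOfEq _ _ h2).trans (LinearMap.quotKerEquivOfSurjective _ h1)⟩

theorem finite_finrank_of_le (h : Z ≤ B) :
    Module.Finite K (Subquotient Z B) ∧ Module.finrank K (Subquotient Z B) = 0 := by
  have : Subsingleton (Subquotient Z B) := by
    rw [Submodule.Quotient.subsingleton_iff]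
    exact eq_top_iff.2 fun z _ => h z.2
  exact ⟨inferInstance, Module.finrank_zero_of_subsingleton⟩

theorem le_of_finrank_eq_zero (h : Module.Finite K (Subquotient Z B))
    (h0 : Module.finrank K (Subquotient Z B) = 0) : Z ≤ B := by
  have : Subsingleton (Subquotient Z B) := Module.finrank_zero_iff.1 h0
  rw [Submodule.Quotient.subsingleton_iff] at this
  intro z hz
  have h1 : (⟨z, hz⟩ : Z) ∈ B.submoduleOf Z := this ▸ Submodule.mem_top
  exact h1

end Subquotients

/-! ### Monomial ideals with linear quotients -/

section LinearQuotients

variable {n : ℕ} {K : Type*} [Field K]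

/-- The action of the variables on `S / (X k : k ∈ A)`, realized on polynomials not involving the
variables from `A`. -/
noncomputable def killAct (K : Type*) [Field K] (A : Finset (Fin n)) (k : Fin n) :
    Module.End K (MvPolynomial (Fin n) K) := if k ∈ A then 0 else varAct n K _ k

theorem killAct_of_mem {A : Finset (Fin n)} {k : Fin n} (h : k ∈ A) : killAct K A k = 0 := if_pos h

theorem killAct_of_notMem {A : Finset (Fin n)} {k : Fin n} (h : k ∉ A) :
    killAct K A k = varAct n K _ k := if_neg h

/-- The grading of `S / (X k : k ∈ A)`, shifted by `d`. -/
noncomputable def killGr (K : Type*) [Field K] (A : Finset (Fin n)) (d : ℕ) (j : ℤ) :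
    Submodule K (MvPolynomial (Fin n) K) where
  carrier := {x | ∀ m ∈ x.support, (m.degree : ℤ) + d = j ∧ Disjoint m.support A}
  add_mem' := fun {x y} hx hy m hm => by
    rcases Finset.mem_union.1 (support_add hm) with h | h
    · exact hx m h
    · exact hy m h
  zero_mem' := fun m hm => by simp at hm
  smul_mem' := fun c x hx m hm => hx m (support_smul hm)

theorem mem_killGr {A : Finset (Fin n)} {d : ℕ} {j : ℤ} {x : MvPolynomial (Fin n) K} :
    x ∈ killGr K A d j ↔
      ∀ m, coeff m x ≠ 0 → (m.degree : ℤ) + d = j ∧ Disjoint m.support A := by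
  simp only [← mem_support_iff]
  rfl

theorem isGradedFor_killGr (A : Finset (Fin n)) (d : ℕ) :
    IsGradedFor (killAct K A) (killGr K A d) where
  comm k l m := by
    by_cases hk : k ∈ A
    · simp [killAct_of_mem hk]
    · by_cases hl : l ∈ A
      · simp [killAct_of_mem hl]
      · rw [killAct_of_notMem hk, killAct_of_notMem hl, varAct_comm]
  act k j x hx := by
    by_cases hk : k ∈ A
    · simp [killAct_of_mem hk]
    · rw [killAct_of_notMem hk]
      intro m hm
      rw [varAct_apply, smul_eq_mul, support_X_mul, Finset.mem_map] at hm
      obtain ⟨m', hm', rfl⟩ := hm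
      obtain ⟨h1, h2⟩ := hx m' hm'
      simp only [addLeftEmbedding_apply, map_add, Finsupp.degree_single]
      refine ⟨by push_cast; omega, ?_⟩
      rw [Finset.disjoint_left] at h2 ⊢
      intro l hl hlA
      rcases Finset.mem_union.1 (Finsupp.support_add hl) with h | h
      · rw [Finset.mem_singleton.1 (Finsupp.support_single_subset h)] at hlA
        exact hk hlA
      · exact h2 h hlA

theorem coeff_zero_killAct (A : Finset (Fin n)) (k : Fin n) (f : MvPolynomial (Fin n) K) :
    lcoeff K (0 : Fin n →₀ ℕ) (killAct K A k f) = 0 := by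
  by_cases hk : k ∈ A
  · simp [killAct_of_mem hk]
  · rw [killAct_of_notMem hk, varAct_apply, lcoeff_apply, smul_eq_mul, coeff_X_mul']
    simp

/-- Only the variables outside `A` can be divided by, so constant terms at subsets of `A` remain as
the sole obstruction. -/
theorem mem_koszulBoundaries_kill {A : Finset (Fin n)} {d i : ℕ} {j : ℤ}
    {z : Finset (Fin n) → MvPolynomial (Fin n) K}
    (hz : z ∈ koszulCycles (killAct K A) (killGr K A d) i j)
    (h0 : ∀ B, B ⊆ A → coeff 0 (z B) = 0) :
    z ∈ koszulBoundaries (killAct K A) (killGr K A d) i j := by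
  refine mem_koszulBoundaries_of_division (isGradedFor_killGr A d) Aᶜ
    (fun k => divMap (Finsupp.single k 1)) ?_ ?_ ?_ ?_ (lcoeff K 0)
    (coeff_zero_killAct A) ?_ hz ?_
  · intro k hk m
    rw [killAct_of_notMem (Finset.mem_compl.1 hk)]
    exact divMap_X_mul_self k m
  · intro k _ l hl m
    by_cases hlA : l ∈ A
    · simp [killAct_of_mem hlA]
    · rw [killAct_of_notMem hlA]
      exact divMap_X_mul hl m
  · intro k _ l _ m
    exact divMap_comm _ _ _
  · intro k _ j x hx
    rw [mem_killGr] at hx ⊢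
    intro m hm
    rw [coeff_divMap] at hm
    obtain ⟨h1, h2⟩ := hx _ hm
    rw [map_add, Finsupp.degree_single] at h1
    push_cast at h1
    refine ⟨by omega, h2.mono_left fun a ha => ?_⟩
    rw [Finsupp.mem_support_iff] at ha ⊢
    rw [Finsupp.add_apply]
    omega
  · intro j x hx h1 h2
    rw [mem_killGr] at hx
    ext m
    rcases eq_or_ne m 0 with rfl | hm
    · exact h2
    · by_contra h3
      obtain ⟨k, hk⟩ := Finsupp.ne_iff.1 hm
      have hkA := Finset.disjoint_left.1 (hx m h3).2 (Finsupp.mem_support_iff.2 hk)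
      have h4 := congrArg (coeff (m - Finsupp.single k 1)) (h1 k (Finset.mem_compl.2 hkA))
      rw [coeff_divMap, add_tsub_cancel_of_le] at h4
      · exact h3 h4
      · rw [Finsupp.single_le_iff]
        exact Nat.one_le_iff_ne_zero.2 hk
  · intro B hB
    refine h0 B fun k hk => ?_
    by_contra hkA
    exact Finset.disjoint_left.1 hB hk (Finset.mem_compl.2 hkA)

/-- Constants live in internal degree `d`, so in homological degree `i` they occur only in degree `d
+ i`. -/
theorem koszulCycles_kill_le {A : Finset (Fin n)} {d i : ℕ} {j : ℤ} (hj : (d : ℤ) + i ≠ j) :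
    koszulCycles (killAct K A) (killGr K A d) i j ≤
      koszulBoundaries (killAct K A) (killGr K A d) i j := by
  intro z hz
  refine mem_koszulBoundaries_kill hz fun B _ => ?_
  by_cases hB : B.card = i
  · by_contra h
    have := (mem_killGr.1 (hz.1.1 B hB) 0 h).1
    simp only [map_zero, Nat.cast_zero, zero_add] at this
    omega
  · rw [hz.1.2 B hB, coeff_zero]

/-- The constant terms at the `i`-subsets of `A` determine the class. Every choice of them is a
cycle, since the variables in `A` act by zero. -/
theorem nonempty_koszulHomology_kill_equiv (A : Finset (Fin n)) (d i : ℕ) :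
    Nonempty (KoszulHomology (killAct K A) (killGr K A d) i (d + i) ≃ₗ[K]
      (Finset.powersetCard i A → K)) := by
  classical
  refine nonempty_subquotient_equiv
    (LinearMap.pi fun B : Finset.powersetCard i A => lcoeff K 0 ∘ₗ LinearMap.proj B.1) ?_ ?_
  · intro g
    refine ⟨fun B => if h : B ∈ Finset.powersetCard i A then C (g ⟨B, h⟩) else 0, ⟨⟨?_, ?_⟩, ?_⟩, ?_⟩
    · intro B hB
      dsimp only
      split_ifs with h
      · rw [mem_killGr]
        intro m hm
        rw [coeff_C] at hm
        split_ifs at hm with h0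
        · subst h0
          simp
        · exact absurd rfl hm
      · exact Submodule.zero_mem _
    · intro B hB
      exact dif_neg fun h => hB (Finset.mem_powersetCard.1 h).2
    · change koszulD _ _ = 0
      ext1 B
      rw [koszulD_apply]
      refine Finset.sum_eq_zero fun k hk => ?_
      by_cases hkA : k ∈ A
      · simp [killAct_of_mem hkA]
      · rw [dif_neg fun h => hkA ((Finset.mem_powersetCard.1 h).1 (Finset.mem_insert_self k B)),
          map_zero, smul_zero]
    · ext B
      simp only [LinearMap.pi_apply, LinearMap.comp_apply, LinearMap.proj_apply, lcoeff_apply]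
      rw [dif_pos B.2, coeff_zero_C]
  · intro z hz
    constructor
    · intro h
      refine mem_koszulBoundaries_kill hz fun B hB => ?_
      by_cases hi : B.card = i
      · exact congrFun h ⟨B, Finset.mem_powersetCard.2 ⟨hB, hi⟩⟩
      · rw [hz.1.2 B hi, coeff_zero]
    · rintro ⟨w, _, rfl⟩
      ext B
      simp only [LinearMap.pi_apply, LinearMap.comp_apply, LinearMap.proj_apply, Pi.zero_apply]
      rw [koszulD_apply, map_sum]
      refine Finset.sum_eq_zero fun k _ => ?_
      rw [map_smul, coeff_zero_killAct, smul_zero]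

theorem finite_finrank_koszulHomology_kill (A : Finset (Fin n)) (d i : ℕ) (j : ℤ) :
    Module.Finite K (KoszulHomology (killAct K A) (killGr K A d) i j) ∧
      Module.finrank K (KoszulHomology (killAct K A) (killGr K A d) i j) =
        if (d : ℤ) + i = j then A.card.choose i else 0 := by
  split_ifs with h
  · subst h
    obtain ⟨e⟩ := nonempty_koszulHomology_kill_equiv (K := K) A d i
    refine ⟨Module.Finite.equiv e.symm, ?_⟩
    rw [e.finrank_eq, Module.finrank_pi, Fintype.card_coe, Finset.card_powersetCard]
  · exact finite_finrank_of_le (koszulCycles_kill_le h)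

/-- The map setting the variables from `A` to zero. -/
noncomputable def killMap (K : Type*) [Field K] (A : Finset (Fin n)) :
    MvPolynomial (Fin n) K →ₗ[K] MvPolynomial (Fin n) K :=
  (basisMonomials (Fin n) K).constr K fun m => if Disjoint m.support A then monomial m 1 else 0

theorem coeff_killMap (A : Finset (Fin n)) (f : MvPolynomial (Fin n) K) (m : Fin n →₀ ℕ) :
    coeff m (killMap K A f) = if Disjoint m.support A then coeff m f else 0 := by
  classical
  induction f using MvPolynomial.induction_on' with
  | monomial u c =>
    have h : monomial u c = c • basisMonomials (Fin n) K u := by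
      rw [coe_basisMonomials, smul_monomial, smul_eq_mul, mul_one]
    rw [h, map_smul, killMap, Module.Basis.constr_basis, coeff_smul, coeff_smul, coe_basisMonomials]
    by_cases hu : u = m
    · subst hu
      split_ifs <;> simp
    · split_ifs <;> simp [coeff_monomial, hu]
  | add p q hp hq =>
    rw [map_add, coeff_add, hp, hq, coeff_add]
    split_ifs <;> simp

/-- The ideal generated by the monomials with exponents in `s`. -/
noncomputable def monoIdeal (K : Type*) [Field K] (s : Set (Fin n →₀ ℕ)) : Ideal (MvPolynomial (Fin n) K) :=
  Ideal.span ((fun a => monomial a (1 : K)) '' s)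

theorem mem_monoIdeal {s : Set (Fin n →₀ ℕ)} {f : MvPolynomial (Fin n) K} :
    f ∈ monoIdeal K s ↔ ∀ m, coeff m f ≠ 0 → ∃ v ∈ s, v ≤ m := by
  simp only [monoIdeal, mem_ideal_span_monomial_image, mem_support_iff]

/-- Adding a generator `x^u` to a monomial ideal with colon ideal `(X k : k ∈ A)`. -/
theorem isKoszulExact_insert {s : Set (Fin n →₀ ℕ)} {u : Fin n →₀ ℕ} {A : Finset (Fin n)}
    (h₁ : ∀ k ∈ A, ∃ v ∈ s, v ≤ u + Finsupp.single k 1) (h₂ : ∀ v ∈ s, ∃ k ∈ A, u k < v k) :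
    IsKoszulExact (varAct n K _) (killAct K A) (idealGr (monoIdeal K s))
      (idealGr (monoIdeal K (insert u s))) (killGr K A u.degree) (killMap K A ∘ₗ divMap u) := by
  classical
  have hb : ∀ f m, coeff m ((killMap K A ∘ₗ divMap u) f) =
      if Disjoint m.support A then coeff (u + m) f else 0 := by
    intro f m
    rw [LinearMap.comp_apply, coeff_killMap, coeff_divMap]
  have hcolon : ∀ v ∈ s, ∀ m, Disjoint m.support A → ¬ v ≤ u + m := by
    intro v hv m hm hvm
    obtain ⟨k, hkA, hk⟩ := h₂ v hv
    have h3 := hvm k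
    have h4 : m k = 0 := by
      by_contra h
      exact Finset.disjoint_left.1 hm (Finsupp.mem_support_iff.2 h) hkA
    rw [Finsupp.add_apply] at h3
    omega
  refine ⟨isGradedFor_idealGr _, ?_, ?_, ?_, ?_, ?_⟩
  · intro j
    exact inf_le_inf (Ideal.span_mono (Set.image_mono (Set.subset_insert u s))) le_rfl
  · rintro k j f ⟨hf, -⟩
    have hf' := mem_monoIdeal.1 hf
    -- Equivariance needs `f` to lie in the ideal: the monomial `x^(u+m) / x_k` is not divisible by
    -- `x^u`, as `m k = 0`, and it is not in the smaller ideal by `hcolon`. So multiplication by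
    -- `x_k` creates no term that division by `x^u` had missed.
    have hvan : ∀ m : Fin n →₀ ℕ, Disjoint m.support A → m k = 0 → u k ≠ 0 →
        coeff (u + m - Finsupp.single k 1) f = 0 := by
      intro m hm hmk huk
      by_contra h
      obtain ⟨v, hv, hvm⟩ := hf' _ h
      rcases hv with rfl | hv
      · have h3 := hvm k
        simp only [Finsupp.coe_tsub, Finsupp.coe_add, Pi.sub_apply, Pi.add_apply,
          Finsupp.single_eq_same] at h3
        omega
      · exact hcolon v hv m hm (hvm.trans tsub_le_self)
    have hX : ∀ m : Fin n →₀ ℕ, Disjoint m.support A → m k = 0 →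
        coeff (u + m) (X k * f) = 0 := by
      intro m hm hmk
      rw [coeff_X_mul']
      split_ifs with h
      · refine hvan m hm hmk ?_
        rw [Finsupp.mem_support_iff, Finsupp.add_apply] at h
        omega
      · rfl
    ext m
    rw [hb, varAct_apply, smul_eq_mul]
    by_cases hk : k ∈ A
    · rw [killAct_of_mem hk, LinearMap.zero_apply, coeff_zero]
      split_ifs with h
      · refine hX m h ?_
        by_contra h'
        exact Finset.disjoint_left.1 h (Finsupp.mem_support_iff.2 h') hk
      · rfl
    · rw [killAct_of_notMem hk, varAct_apply, smul_eq_mul]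
      by_cases hmk : k ∈ m.support
      · obtain ⟨m', rfl⟩ : ∃ m', m = Finsupp.single k 1 + m' :=
          ⟨m - Finsupp.single k 1, (add_tsub_cancel_of_le (by
            rw [Finsupp.single_le_iff]
            exact Nat.one_le_iff_ne_zero.2 (Finsupp.mem_support_iff.1 hmk))).symm⟩
        rw [coeff_X_mul, hb, add_left_comm, coeff_X_mul]
        have : Disjoint (Finsupp.single k 1 + m').support A ↔ Disjoint m'.support A := by
          have h3 : (Finsupp.single k 1 + m').support = insert k m'.support := by
            ext l
            by_cases hl : l = k
            · simp [hl]
            · simp [hl]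
          rw [h3, Finset.disjoint_insert_left]
          simp [hk]
        simp only [this]
      · rw [coeff_X_mul' m, if_neg hmk]
        split_ifs with h
        · exact hX m h (Finsupp.notMem_support_iff.1 hmk)
        · rfl
  · rintro j f ⟨-, hf⟩
    rw [mem_killGr]
    intro m hm
    rw [hb] at hm
    split_ifs at hm with h
    · have := hf _ (mem_support_iff.2 hm)
      rw [map_add] at this
      push_cast at this
      exact ⟨by omega, h⟩
    · exact absurd rfl hm
  · intro j q hq
    rw [mem_killGr] at hq
    refine ⟨monomial u 1 * q, ⟨?_, ?_⟩, ?_⟩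
    · exact Ideal.mul_mem_right _ _ (Ideal.subset_span ⟨u, Set.mem_insert u s, rfl⟩)
    · intro m hm
      rw [mem_support_iff, coeff_monomial_mul'] at hm
      split_ifs at hm with h
      · rw [one_mul] at hm
        obtain ⟨h3, -⟩ := hq _ hm
        rw [← h3, ← Nat.cast_add, ← map_add, tsub_add_cancel_of_le h]
      · exact absurd rfl hm
    · ext m
      rw [hb, coeff_monomial_mul, one_mul]
      split_ifs with h
      · rfl
      · by_contra h3
        exact h (hq m (Ne.symm h3)).2
  · rintro j f ⟨hf, hfj⟩
    have hf' := mem_monoIdeal.1 hf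
    constructor
    · intro h0
      refine ⟨mem_monoIdeal.2 fun m hm => ?_, hfj⟩
      obtain ⟨v, hv, hvm⟩ := hf' m hm
      rcases hv with rfl | hv
      · obtain ⟨m', rfl⟩ : ∃ m', m = v + m' := ⟨m - v, (add_tsub_cancel_of_le hvm).symm⟩
        have h3 := hb f m'
        rw [h0, coeff_zero] at h3
        split_ifs at h3 with h4
        · exact absurd h3.symm hm
        · obtain ⟨k, hk, hkA⟩ := Finset.not_disjoint_iff.1 h4
          obtain ⟨w, hw, hwv⟩ := h₁ k hkA
          refine ⟨w, hw, hwv.trans (add_le_add le_rfl ?_)⟩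
          rw [Finsupp.single_le_iff]
          exact Nat.one_le_iff_ne_zero.2 (Finsupp.mem_support_iff.1 hk)
      · exact ⟨v, hv, hvm⟩
    · rintro ⟨hJ, -⟩
      ext m
      rw [hb, coeff_zero]
      split_ifs with h
      · by_contra h3
        obtain ⟨v, hv, hvm⟩ := mem_monoIdeal.1 hJ _ h3
        exact hcolon v hv m h hvm
      · rfl

/-- The Koszul homology of a monomial ideal with linear quotients. -/
theorem finite_finrank_koszulHomology_of_linearQuotients {α : Type*} [LinearOrder α]
    (f : (Fin n →₀ ℕ) → α) (hf : Function.Injective f) (G : Finset (Fin n →₀ ℕ))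
    (A : (Fin n →₀ ℕ) → Finset (Fin n))
    (h₁ : ∀ u ∈ G, ∀ k ∈ A u, ∃ v ∈ G, f v < f u ∧ v ≤ u + Finsupp.single k 1)
    (h₂ : ∀ u ∈ G, ∀ v ∈ G, f v < f u → ∃ k ∈ A u, u k < v k)
    (h₃ : ∀ u ∈ G, ∀ v ∈ G, f v < f u → v.degree ≤ u.degree) (i : ℕ) (j : ℤ) :
    Module.Finite K (KoszulHomology (varAct n K _)
        (idealGr (monoIdeal K (G : Set (Fin n →₀ ℕ)))) i j) ∧
      Module.finrank K (KoszulHomology (varAct n K _)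
        (idealGr (monoIdeal K (G : Set (Fin n →₀ ℕ)))) i j) =
        ∑ u ∈ G, if (u.degree : ℤ) + i = j then (A u).card.choose i else 0 := by
  classical
  -- Generators are added in increasing order of `f`, so only initial segments of `G` occur.
  have key : ∀ s : Finset (Fin n →₀ ℕ), s ⊆ G → (∀ u ∈ s, ∀ v ∈ G, f v < f u → v ∈ s) →
      ∀ (i : ℕ) (j : ℤ),
      Module.Finite K (KoszulHomology (varAct n K _)
          (idealGr (monoIdeal K (s : Set (Fin n →₀ ℕ)))) i j) ∧
      Module.finrank K (KoszulHomology (varAct n K _)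
          (idealGr (monoIdeal K (s : Set (Fin n →₀ ℕ)))) i j) =
        ∑ u ∈ s, if (u.degree : ℤ) + i = j then (A u).card.choose i else 0 := by
    intro s
    induction s using Finset.induction_on_max_value f with
    | empty =>
      intro _ _ i j
      rw [Finset.sum_empty]
      refine finite_finrank_of_le fun z hz => ?_
      have : z = 0 := by
        ext1 B
        by_cases hB : B.card = i
        · ext m
          by_contra h
          obtain ⟨v, hv, -⟩ := mem_monoIdeal.1 (hz.1.1 B hB).1 m h
          simp at hv
        · exact hz.1.2 B hB
      rw [this]
      exact Submodule.zero_mem _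
    | insert u s hu hmax ih =>
      intro hsG hini i j
      rw [Finset.insert_subset_iff] at hsG
      have hlt : ∀ v ∈ s, f v < f u := fun v hv =>
        lt_of_le_of_ne (hmax v hv) fun h => hu (hf h ▸ hv)
      have hini' : ∀ v ∈ s, ∀ w ∈ G, f w < f v → w ∈ s := by
        intro v hv w hw hwv
        rcases Finset.mem_insert.1 (hini v (Finset.mem_insert_of_mem hv) w hw hwv) with rfl | h
        · exact absurd (hwv.trans (hlt v hv)) (lt_irrefl _)
        · exact h
      have ih' := ih hsG.2 hini'
      have hbelow : ∀ v ∈ G, f v < f u → v ∈ s := by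
        intro v hv hvu
        rcases Finset.mem_insert.1 (hini u (Finset.mem_insert_self u s) v hv hvu) with rfl | h
        · exact absurd hvu (lt_irrefl _)
        · exact h
      have hex := isKoszulExact_insert (K := K) (s := (s : Set (Fin n →₀ ℕ))) (u := u) (A := A u)
        (fun k hk => by
          obtain ⟨v, hv, hvu, hle⟩ := h₁ u hsG.1 k hk
          exact ⟨v, hbelow v hv hvu, hle⟩)
        (fun v hv => h₂ u hsG.1 v (hsG.2 hv) (hlt v hv))
      -- The earlier generators have degree at most `u.degree`, so in homological degree `i` their
      -- ideal has no homology above internal degree `u.degree + i`. The new quotient has homology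
      -- in degree `i + 1` only at `u.degree + i + 1`; hence the connecting maps vanish.
      have hvan : ∀ (i : ℕ) (j : ℤ), (u.degree : ℤ) + i < j →
          koszulCycles (varAct n K _)
          (idealGr (monoIdeal K (s : Set (Fin n →₀ ℕ)))) i j ≤
            koszulBoundaries (varAct n K _)
          (idealGr (monoIdeal K (s : Set (Fin n →₀ ℕ)))) i j := by
        intro i j hij
        refine le_of_finrank_eq_zero (ih' i j).1 ?_
        rw [(ih' i j).2]
        refine Finset.sum_eq_zero fun v hv => if_neg ?_
        have := h₃ u hsG.1 v (hsG.2 hv) (hlt v hv)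
        omega
      obtain ⟨h'', h4⟩ := finite_finrank_koszulHomology_kill (K := K) (A u) u.degree i j
      rw [Finset.coe_insert, Finset.sum_insert hu, ← h4, ← (ih' i j).2, add_comm]
      refine hex.finite_finrank_add ?_ ?_ (ih' i j).1 h''
      · by_cases hj : (u.degree : ℤ) + (i + 1 : ℕ) = j
        · refine Or.inr (hvan i j ?_)
          push_cast at hj
          omega
        · exact Or.inl (koszulCycles_kill_le hj)
      · by_cases hj : (u.degree : ℤ) + i = j
        · refine Or.inr ?_
          rcases i with _ | i
          · exact Or.inl rfl
          · refine Or.inr ⟨i, rfl, hvan i j ?_⟩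
            push_cast at hj
            omega
        · exact Or.inl (koszulCycles_kill_le hj)
  exact key G subset_rfl (fun _ _ v hv _ => hv) i j

end LinearQuotients

/-! ### Colon ideals of shifted sets of exponents -/

section Combinatorics

variable {n : ℕ}

/-- The largest entry of a sequence. -/
def maxPart (u : Fin n → ℕ) : ℕ := Finset.univ.sup u

theorem le_maxPart (u : Fin n → ℕ) (k : Fin n) : u k ≤ maxPart u :=
  Finset.le_sup (Finset.mem_univ k)

theorem exists_eq_maxPart (u : Fin n → ℕ) (k : Fin n) : ∃ j, u j = maxPart u := by
  obtain ⟨j, _, hj⟩ := Finset.exists_mem_eq_sup Finset.univ ⟨k, Finset.mem_univ k⟩ u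
  exact ⟨j, hj.symm⟩

/-- The variables generating the colon ideal of the generator `x^u`. -/
def colonSet (u : Fin n → ℕ) : Finset (Fin n) :=
  Finset.univ.filter fun k => u k + 1 < maxPart u ∨ (u k + 1 = maxPart u ∧ ∃ j, k < j ∧
    u j = maxPart u)

/-- The order on the generators: by degree, then by the sum of squares, then reverse
lexicographically. -/
noncomputable def orderKey (u : Fin n →₀ ℕ) : ℕ ×ₗ ℕ ×ₗ (Lex (Fin n → ℕ))ᵒᵈ :=
  toLex (u.degree, toLex (∑ k, u k ^ 2, OrderDual.toDual (toLex ⇑u)))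

theorem orderKey_injective : Function.Injective (orderKey (n := n)) := by
  intro u v h
  have h1 := congrArg (fun x => ofLex (OrderDual.ofDual (ofLex (ofLex x).2).2)) h
  exact DFunLike.coe_injective h1

theorem orderKey_lt_iff {u v : Fin n →₀ ℕ} : orderKey u < orderKey v ↔ u.degree < v.degree ∨
    u.degree = v.degree ∧ (∑ k, u k ^ 2 < ∑ k, v k ^ 2 ∨ ∑ k, u k ^ 2 = ∑ k, v k ^ 2 ∧
      ∃ k, (∀ l, l < k → v l = u l) ∧ v k < u k) := by
  rw [orderKey, orderKey, Prod.Lex.toLex_lt_toLex, Prod.Lex.toLex_lt_toLex,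
    OrderDual.toDual_lt_toDual]
  rfl

theorem eq_of_le_of_degree_le {u v : Fin n →₀ ℕ} (h : u ≤ v) (hd : v.degree ≤ u.degree) :
    u = v := by
  have h1 := congrArg Finsupp.degree (add_tsub_cancel_of_le h)
  rw [map_add] at h1
  have h2 : (v - u).degree = 0 := by omega
  rw [Finsupp.degree_eq_zero_iff] at h2
  rw [← add_tsub_cancel_of_le h, h2, add_zero]

theorem degree_le_of_le {u v : Fin n →₀ ℕ} (h : u ≤ v) : u.degree ≤ v.degree := by
  rw [Finsupp.degree_eq_sum, Finsupp.degree_eq_sum]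
  exact Finset.sum_le_sum fun k _ => h k

/-- Moving one unit from the entry `j` to the entry `k`. -/
noncomputable def moveUnit (a : Fin n →₀ ℕ) (j k : Fin n) : Fin n →₀ ℕ :=
  a - Finsupp.single j 1 + Finsupp.single k 1

theorem moveUnit_apply (a : Fin n →₀ ℕ) (j k x : Fin n) :
    moveUnit a j k x = a x - (if x = j then 1 else 0) + (if x = k then 1 else 0) := by
  simp only [moveUnit, Finsupp.coe_add, Finsupp.coe_tsub, Pi.add_apply, Pi.sub_apply,
    Finsupp.single_apply, eq_comm]

theorem degree_moveUnit {a : Fin n →₀ ℕ} {j : Fin n} (hj : 0 < a j) (k : Fin n) :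
    (moveUnit a j k).degree = a.degree := by
  have h : Finsupp.single j 1 ≤ a := by
    rw [Finsupp.single_le_iff]
    exact hj
  conv_rhs => rw [← tsub_add_cancel_of_le h]
  rw [moveUnit, map_add, map_add, Finsupp.degree_single, Finsupp.degree_single]

/-- The sum of squares drops strictly unless the two entries differ by one; in that case the move
merely exchanges their values. -/
theorem sum_sq_moveUnit {a : Fin n →₀ ℕ} {j k : Fin n} (hkj : a k < a j) :
    ((∑ x, moveUnit a j k x ^ 2 : ℕ) : ℤ) = (∑ x, a x ^ 2 : ℕ) + 2 * (a k + 1 - a j) := by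
  have hne : j ≠ k := fun h => by simp [h] at hkj
  have h : ∀ x, ((moveUnit a j k x : ℕ) : ℤ) ^ 2 = (a x : ℤ) ^ 2 +
      (if x = j then 1 - 2 * (a j : ℤ) else 0) + (if x = k then 2 * (a k : ℤ) + 1 else 0) := by
    intro x
    rw [moveUnit_apply]
    by_cases hxj : x = j
    · subst hxj
      rw [if_pos rfl, if_neg hne, if_pos rfl, if_neg hne, add_zero,
        Nat.cast_sub (by omega)]
      push_cast
      ring
    · by_cases hxk : x = k
      · subst hxk
        rw [if_neg hxj, if_pos rfl, if_neg hxj, if_pos rfl, Nat.sub_zero]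
        push_cast
        ring
      · simp [hxj, hxk]
  push_cast
  rw [Finset.sum_congr rfl fun x _ => h x, Finset.sum_add_distrib, Finset.sum_add_distrib,
    Finset.sum_ite_eq' Finset.univ j, Finset.sum_ite_eq' Finset.univ k]
  simp only [Finset.mem_univ, if_true]
  ring

variable {P : (Fin n →₀ ℕ) → Prop}

/-- Monomials that exceed `u` only in entries that are almost maximal in `u` can be moved below
`u`. -/
theorem exists_le_of_exchange
    (hP : ∀ a, P a → ∀ j k, (∀ l, a l ≤ a j) → a k < a j → P (moveUnit a j k))
    {u v : Fin n →₀ ℕ} {M : ℕ} (hM : ∀ l, u l ≤ M) (hv : P v) (huv : ∀ k, u k < v k → M ≤ u k + 1)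
    (hd : v.degree ≤ u.degree) : ∃ w, P w ∧ w ≤ u ∧ w.degree = v.degree := by
  induction hN : ∑ k, (v k - u k) using Nat.strong_induction_on generalizing v with
  | _ N ih =>
  by_cases hle : v ≤ u
  · exact ⟨v, hv, hle, rfl⟩
  obtain ⟨k₀, hk₀⟩ : ∃ k, u k < v k := by
    by_contra h
    exact hle fun k => not_lt.1 fun h' => h ⟨k, h'⟩
  obtain ⟨j, hj⟩ : ∃ j, v j < u j := by
    by_contra! h
    rw [Finsupp.degree_eq_sum, Finsupp.degree_eq_sum] at hd
    exact absurd (Finset.sum_lt_sum (fun k _ => h k) ⟨k₀, Finset.mem_univ _, hk₀⟩) hd.not_gt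
  -- A maximal entry of `v` that also exceeds `u` is needed. If the maximum of `v` is larger than `v
  -- k₀`, it is at least `M + 1`, hence larger than every entry of `u`.
  obtain ⟨s, hs, hus⟩ : ∃ s, (∀ l, v l ≤ v s) ∧ u s < v s := by
    obtain ⟨t, -, ht⟩ := Finset.exists_max_image Finset.univ v ⟨k₀, Finset.mem_univ _⟩
    rcases (ht k₀ (Finset.mem_univ _)).eq_or_lt with h | h
    · exact ⟨k₀, fun l => h ▸ ht l (Finset.mem_univ _), hk₀⟩
    · refine ⟨t, fun l => ht l (Finset.mem_univ _), ?_⟩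
      have := huv k₀ hk₀
      have := hM t
      omega
  have h1 := huv s hus
  have h2 := hM j
  have hjs : v j < v s := by omega
  have hne : s ≠ j := fun h => by simp [h] at hjs
  have hdeg := degree_moveUnit (a := v) (j := s) (by omega) j
  have hval : ∀ k, moveUnit v s j k = if k = s then v s - 1 else if k = j then v j + 1 else v k := by
    intro k
    rw [moveUnit_apply]
    split_ifs with h3 h4 h4
    · exact absurd (h3.symm.trans h4) hne
    · rw [h3, add_zero]
    · rw [h4, Nat.sub_zero]
    · simp
  -- The move from `s` to `j` lowers the excess of `v` over `u` at `s` and creates none at `j`,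
  -- where `v j < u j`.
  obtain ⟨w, hw, hwu, hwd⟩ := ih (∑ k, (moveUnit v s j k - u k)) (by
      rw [← hN]
      refine Finset.sum_lt_sum (fun k _ => ?_) ⟨s, Finset.mem_univ _, ?_⟩
      · rw [hval]
        split_ifs with h3 h4
        · subst h3
          omega
        · subst h4
          omega
        · exact le_rfl
      · rw [hval, if_pos rfl]
        omega) (hP v hv s j hs hjs) (fun k hk => by
      rw [hval] at hk
      split_ifs at hk with h3 h4
      · exact h3 ▸ h1
      · subst h4
        omega
      · exact huv k hk) (hdeg.trans_le hd) rfl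
  exact ⟨w, hw, hwu, hwd.trans hdeg⟩

/-- Moving a unit from a maximal entry `j` to `k` gives an element of `P` below `u + e_k`. If the
generator below it has the degree of `u`, it is this element itself. It precedes `u` by the sum of
squares when the gap is at least two; when the gap is one, the tie-break applies, since the first
change, at `k < j`, is an increase. -/
theorem exists_colon
    (hP : ∀ a, P a → ∀ j k, (∀ l, a l ≤ a j) → a k < a j → P (moveUnit a j k))
    {u : Fin n →₀ ℕ} (hu : Minimal P u) {k : Fin n} (hk : k ∈ colonSet u) :
    ∃ v, Minimal P v ∧ orderKey v < orderKey u ∧ v ≤ u + Finsupp.single k 1 := by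
  obtain ⟨j, hj, hkj, hjk⟩ : ∃ j, u j = maxPart u ∧ u k < u j ∧
      (u k + 1 < u j ∨ (u k + 1 = u j ∧ k < j)) := by
    rcases (Finset.mem_filter.1 hk).2 with h | ⟨h, j, hkj, hj⟩
    · obtain ⟨j, hj⟩ := exists_eq_maxPart u k
      exact ⟨j, hj, by omega, Or.inl (by omega)⟩
    · exact ⟨j, hj, by omega, Or.inr ⟨by omega, hkj⟩⟩
  obtain ⟨v, hvw, hv⟩ := exists_minimal_le_of_wellFoundedLT P _
    (hP u hu.1 j k (fun l => hj ▸ le_maxPart u l) hkj)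
  refine ⟨v, hv, ?_, hvw.trans (add_le_add tsub_le_self le_rfl)⟩
  have hd : (moveUnit u j k).degree = u.degree := degree_moveUnit (by omega) k
  rw [orderKey_lt_iff]
  rcases (degree_le_of_le hvw).lt_or_eq with h | h
  · exact Or.inl (hd ▸ h)
  · obtain rfl := eq_of_le_of_degree_le hvw h.ge
    refine Or.inr ⟨hd, ?_⟩
    have h1 := sum_sq_moveUnit hkj
    rcases hjk with h2 | ⟨h2, h3⟩
    · exact Or.inl (by omega)
    · refine Or.inr ⟨by omega, k, fun l hl => ?_, ?_⟩
      · rw [moveUnit_apply, if_neg (hl.trans h3).ne, if_neg hl.ne]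
        rfl
      · rw [moveUnit_apply, if_neg h3.ne, if_pos rfl]
        omega

/-- Otherwise `v` exceeds `u` only where `u` is within one of its maximum. If `v` has smaller
degree, the exchange lemma produces an element of `P` properly below `u`, against minimality. In
equal degree, convexity forces `v` to differ from `u` only by exchanging the two top values, and the
tie-break then yields an index in `colonSet u`. -/
theorem exists_mem_colonSet
    (hP : ∀ a, P a → ∀ j k, (∀ l, a l ≤ a j) → a k < a j → P (moveUnit a j k))
    {u v : Fin n →₀ ℕ} (hu : Minimal P u) (hv : Minimal P v) (hvu : orderKey v < orderKey u) :
    ∃ k ∈ colonSet u, u k < v k := by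
  by_contra! hcon
  have hnot : ∀ k, u k < v k → k ∉ colonSet u := fun k hk hk' => absurd hk (hcon k hk').not_gt
  have hM := le_maxPart u
  have hcond : ∀ k, u k < v k → maxPart u ≤ u k + 1 := by
    intro k hk
    by_contra h
    exact hnot k hk (Finset.mem_filter.2 ⟨Finset.mem_univ _, Or.inl (not_le.1 h)⟩)
  rw [orderKey_lt_iff] at hvu
  rcases hvu with hlt | ⟨hdeg, hsq⟩
  · obtain ⟨w, hw, hwu, hwd⟩ := exists_le_of_exchange hP hM hv.1 hcond hlt.le
    have := degree_le_of_le (hu.2 hw hwu)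
    omega
  -- With M the maximum of `u`, `t k` is the increment from `u k` to `v k` of `x ↦ x (x + 1 - 2M)`,
  -- whose minimum over the integers is attained at M - 1 and M. The degrees being equal, the linear
  -- terms cancel in the sum.
  · let t : Fin n → ℤ := fun k => ((v k : ℤ) - u k) * (v k + u k + 1 - 2 * maxPart u)
    have ht : ∀ k, 0 ≤ t k := by
      intro k
      rcases lt_trichotomy (u k) (v k) with h | h | h
      · have := hcond k h
        exact mul_nonneg (by omega) (by omega)
      · simp [t, h]
      · have := hM k
        exact mul_nonneg_of_nonpos_of_nonpos (by omega) (by omega)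
    have hsum : ∑ k, t k = (∑ k, v k ^ 2 : ℕ) - (∑ k, u k ^ 2 : ℕ) := by
      rw [Finsupp.degree_eq_sum, Finsupp.degree_eq_sum] at hdeg
      have hdeg' : (∑ k, (v k : ℤ)) = ∑ k, (u k : ℤ) := by exact_mod_cast hdeg
      have : ∀ k, t k = ((v k : ℤ) ^ 2 - (u k : ℤ) ^ 2) +
          ((v k : ℤ) - (u k : ℤ)) * (1 - 2 * maxPart u) := fun k => by
        simp only [t]
        ring
      rw [Finset.sum_congr rfl fun k _ => this k, Finset.sum_add_distrib, ← Finset.sum_mul,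
        Finset.sum_sub_distrib, Finset.sum_sub_distrib, hdeg', sub_self, zero_mul, add_zero]
      push_cast
      rfl
    have hnn := Finset.sum_nonneg fun k (_ : k ∈ Finset.univ) => ht k
    rcases hsq with hsq | ⟨hsq, k₀, hk₀, hk₀'⟩
    · omega
    · have hz : ∀ k, t k = 0 := by
        have h0 : ∑ k, t k = 0 := by omega
        intro k
        exact (Finset.sum_eq_zero_iff_of_nonneg fun k _ => ht k).1 h0 k (Finset.mem_univ k)
      -- Hence wherever they differ, `u k` and `v k` are M - 1 and M in some order. The first
      -- difference `k₀` is an increase, so the decrease forced by equal degrees lies to its right,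
      -- at an entry M of `u`.
      have hz' : ∀ k, v k ≠ u k → v k + u k + 1 = 2 * maxPart u := by
        intro k hk
        rcases mul_eq_zero.1 (hz k) with h | h
        · omega
        · omega
      obtain ⟨j, hj⟩ : ∃ j, v j < u j := by
        by_contra! h
        rw [Finsupp.degree_eq_sum, Finsupp.degree_eq_sum] at hdeg
        exact absurd (Finset.sum_lt_sum (fun k _ => h k) ⟨k₀, Finset.mem_univ _, hk₀'⟩)
          hdeg.not_gt
      have h1 := hz' j hj.ne
      have h2 := hM j
      have h3 := hz' k₀ hk₀'.ne'
      have h4 := hcond k₀ hk₀'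
      refine hnot k₀ hk₀' (Finset.mem_filter.2 ⟨Finset.mem_univ _, Or.inr ⟨by omega, j, ?_,
        by omega⟩⟩)
      rcases lt_trichotomy j k₀ with h | h | h
      · exact absurd (hk₀ j h) hj.ne'
      · subst h
        omega
      · exact h

end Combinatorics

/-! ### Symmetric shifted ideals have linear quotients -/

section Ideals

variable {n : ℕ} {K : Type*} [Field K] {I : Ideal (MvPolynomial (Fin n) K)}

theorem IsSymmetricIdeal.mapDomain_mem (h : IsSymmetricIdeal I) {a : Fin n →₀ ℕ}
    (ha : monomial a (1 : K) ∈ I) (σ : Equiv.Perm (Fin n)) :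
    monomial (a.mapDomain σ) (1 : K) ∈ I := by
  rw [← rename_monomial, ← h σ]
  exact Ideal.mem_map_of_mem (rename σ : _ →ₐ[K] MvPolynomial (Fin n) K) ha

/-- Shiftedness is given only for sorted exponents and the last entry. The exponent is sorted with
`j` in last place, shifted there, and permuted back. -/
theorem IsSymmetricShifted.moveUnit_mem (h : IsSymmetricShifted I) (a : Fin n →₀ ℕ)
    (ha : monomial a (1 : K) ∈ I) (j k : Fin n) (hj : ∀ l, a l ≤ a j) (hkj : a k < a j) :
    monomial (moveUnit a j k) (1 : K) ∈ I := by
  obtain ⟨l, hl⟩ : ∃ l : Fin n, (l : ℕ) + 1 = n :=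
    ⟨⟨n - 1, by have := k.2; omega⟩, by have := k.2; simp only; omega⟩
  have hll : ∀ x : Fin n, x ≤ l := fun x => by
    have := x.2
    rw [Fin.le_def]
    omega
  let σ₀ := Tuple.sort a
  have hσ₀ : Monotone (a ∘ σ₀) := Tuple.monotone_sort a
  have hmax : a (σ₀ l) = a j := by
    refine le_antisymm (hj _) ?_
    have := hσ₀ (hll (σ₀.symm j))
    simpa using this
  -- Sorting may put another maximal entry last; swapping that one with `j` does not change the
  -- sorted exponent.
  let σ := σ₀.trans (Equiv.swap (σ₀ l) j)
  have hσ : ∀ x, a (σ x) = a (σ₀ x) := by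
    intro x
    change a (Equiv.swap (σ₀ l) j (σ₀ x)) = _
    rw [Equiv.swap_apply_def]
    split_ifs with h1 h2
    · rw [h1, hmax]
    · rw [h2, hmax]
    · rfl
  have hσl : σ l = j := Equiv.swap_apply_left _ _
  have hb : ∀ x, a.mapDomain σ.symm x = a (σ x) := fun x => by
    rw [Finsupp.mapDomain_equiv_apply, Equiv.symm_symm]
  have h1 := h.shifted (a.mapDomain σ.symm) ⟨fun x y hxy => by
      rw [hb, hb, hσ, hσ]
      exact hσ₀ hxy, h.symmetric.mapDomain_mem ha σ.symm⟩ (σ.symm k) l hl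
    (lt_of_le_of_ne (hll _) fun h' => by
      rw [Equiv.symm_apply_eq, hσl] at h'
      rw [h'] at hkj
      exact lt_irrefl _ hkj) (by
      rw [hb, hb, Equiv.apply_symm_apply, hσl]
      exact hkj)
  have h2 := h.symmetric.mapDomain_mem h1 σ
  refine (congrArg (fun b => monomial b (1 : K) ∈ I) ?_).mp h2
  ext x
  have h3 : (l = σ.symm x) = (j = x) := by
    rw [← hσl, eq_iff_iff, Equiv.eq_symm_apply]
  rw [Finsupp.mapDomain_equiv_apply, moveUnit]
  simp only [Finsupp.coe_add, Finsupp.coe_tsub, Pi.add_apply, Pi.sub_apply, hb,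
    Equiv.apply_symm_apply, Finsupp.single_apply, h3, EmbeddingLike.apply_eq_iff_eq]

/-- Dickson's lemma: minimal exponents form an antichain in a well-quasi-order. -/
theorem minimalGenerators_finite (I : Ideal (MvPolynomial (Fin n) K)) :
    (minimalGenerators I).Finite :=
  WellQuasiOrderedLE.finite_of_isAntichain (setOfPred_minimal_antichain _)

theorem monoIdeal_minimalGenerators (hI : IsMonomialIdeal I) :
    monoIdeal K (minimalGenerators I) = I := by
  obtain ⟨A, hA⟩ := hI
  apply le_antisymm
  · rw [monoIdeal, Ideal.span_le]
    rintro _ ⟨a, ha, rfl⟩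
    exact ha.1
  · conv_lhs => rw [hA]
    rw [Ideal.span_le]
    rintro _ ⟨a, ha, rfl⟩
    have h1 : monomial a (1 : K) ∈ I := by
      rw [hA]
      exact Ideal.subset_span ⟨a, ha, rfl⟩
    obtain ⟨b, hba, hb⟩ := exists_minimal_le_of_wellFoundedLT
      (fun b => monomial b (1 : K) ∈ I) a h1
    refine mem_monoIdeal.2 fun m hm => ⟨b, hb, ?_⟩
    classical
    rw [coeff_monomial] at hm
    split_ifs at hm with h
    · exact h ▸ hba
    · exact absurd rfl hm

open Classical in
/-- The minimal generators of degree `d`. -/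
noncomputable def generatorsOfDegree (I : Ideal (MvPolynomial (Fin n) K)) (d : ℕ) :
    Finset (Fin n →₀ ℕ) := (minimalGenerators_finite I).toFinset.filter fun a => a.degree = d

theorem mem_generatorsOfDegree {d : ℕ} {a : Fin n →₀ ℕ} :
    a ∈ generatorsOfDegree I d ↔ a ∈ minimalGenerators I ∧ a.degree = d := by
  simp [generatorsOfDegree]

/-- The order `orderKey` gives linear quotients with colon variables `colonSet`; in internal degree
`i + d` only the generators of degree `d` contribute. -/
theorem IsSymmetricShifted.betti_eq (hI : IsSymmetricShifted I) (F : GradedFreeResolution I)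
    (i d : ℕ) : Module.Finite K (F.Tor i ((i : ℤ) + (d : ℤ))) ∧
      F.betti i ((i : ℤ) + (d : ℤ)) =
        ∑ u ∈ generatorsOfDegree I d, (colonSet u).card.choose i := by
  classical
  let G := (minimalGenerators_finite I).toFinset
  have hG : ∀ u, u ∈ G ↔ Minimal (fun b => monomial b (1 : K) ∈ I) u := fun u =>
    (minimalGenerators_finite I).mem_toFinset
  obtain ⟨h1, h2⟩ := finite_finrank_koszulHomology_of_linearQuotients (K := K) orderKey
    orderKey_injective G (fun u => colonSet u)
    (fun u hu k hk => by
      obtain ⟨v, hv, h⟩ := exists_colon hI.moveUnit_mem ((hG u).1 hu) hk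
      exact ⟨v, (hG v).2 hv, h⟩)
    (fun u hu v hv h => exists_mem_colonSet hI.moveUnit_mem ((hG u).1 hu) ((hG v).1 hv) h)
    (fun u _ v _ h => by
      rcases orderKey_lt_iff.1 h with h | h
      · exact h.le
      · exact h.1.le) i (i + d)
  rw [(minimalGenerators_finite I).coe_toFinset, monoIdeal_minimalGenerators hI.monomial_ideal]
    at h1 h2
  obtain ⟨e⟩ := F.nonempty_koszulHomology_equiv_tor i (i + d)
  refine ⟨Module.Finite.equiv e, ?_⟩
  rw [GradedFreeResolution.betti, ← e.finrank_eq, h2, generatorsOfDegree, Finset.sum_filter]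
  refine Finset.sum_congr rfl fun u _ => if_congr ?_ rfl rfl
  omega

end Ideals

/-! ### Sums over rearrangements and stabilizers -/

section Orbits

variable {n : ℕ}

/-- The number of entries of `f` equal to `v`. -/
def entryCount (f : Fin n → ℕ) (v : ℕ) : ℕ := (Finset.univ.filter fun k => f k = v).card

/-- All rearrangements of `f`. -/
def rearrangements (f : Fin n → ℕ) : Finset (Fin n → ℕ) :=
  Finset.univ.image fun σ : Equiv.Perm (Fin n) => f ∘ σ

/-- The number of permutations fixing `f`. -/
def stabCard (f : Fin n → ℕ) : ℕ :=
  (Finset.univ.filter fun σ : Equiv.Perm (Fin n) => f ∘ σ = f).card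

theorem mem_rearrangements {f c : Fin n → ℕ} : c ∈ rearrangements f ↔ ∃ σ : Equiv.Perm (Fin n),
    f ∘ σ = c := by simp [rearrangements]

theorem stabCard_pos (f : Fin n → ℕ) : 0 < stabCard f :=
  Finset.card_pos.2 ⟨1, Finset.mem_filter.2 ⟨Finset.mem_univ _, rfl⟩⟩

/-- Any strict bound `N` on the entries serves, since values not taken contribute `0! = 1`. -/
theorem stabCard_eq (f : Fin n → ℕ) (N : ℕ) (hN : ∀ k, f k < N) :
    stabCard f = ∏ v ∈ Finset.range N, (entryCount f v).factorial := by
  have h1 := DomMulAct.stabilizer_card' f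
  rw [Fintype.card_subtype] at h1
  rw [stabCard, h1]
  simp only [Fintype.card_subtype]
  refine Finset.prod_subset ?_ ?_
  · intro v hv
    obtain ⟨k, -, rfl⟩ := Finset.mem_image.1 hv
    exact Finset.mem_range.2 (hN k)
  · intro v _ hv
    rw [Finset.filter_eq_empty_iff.2, Finset.card_empty, Nat.factorial_zero]
    intro k _ hk
    exact hv (Finset.mem_image.2 ⟨k, Finset.mem_univ _, hk⟩)

/-- Each rearrangement arises from one coset of the stabilizer of `f`. -/
theorem sum_perm_eq (f : Fin n → ℕ) (φ : (Fin n → ℕ) → ℕ) :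
    ∑ σ : Equiv.Perm (Fin n), φ (f ∘ σ) = stabCard f * ∑ c ∈ rearrangements f, φ c := by
  rw [Finset.sum_comp φ (fun σ : Equiv.Perm (Fin n) => f ∘ σ), Finset.mul_sum]
  refine Finset.sum_congr rfl fun c hc => ?_
  obtain ⟨τ, rfl⟩ := mem_rearrangements.1 hc
  rw [smul_eq_mul]
  congr 1
  refine Finset.card_equiv (Equiv.mulRight τ⁻¹) fun σ => ?_
  simp only [Finset.mem_filter, Finset.mem_univ, true_and, Equiv.coe_mulRight]
  constructor
  · intro h
    funext k
    have := congrFun h (τ⁻¹ k)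
    simpa using this
  · intro h
    funext k
    have := congrFun h (τ k)
    simpa using this

/-- Both sides are the sum of `ψ (π ∘ f ∘ σ)` over all permutations `σ`. -/
theorem sum_rearrangements_comp (f : Fin n → ℕ) (π : ℕ → ℕ) (ψ : (Fin n → ℕ) → ℕ) :
    stabCard f * ∑ c ∈ rearrangements f, ψ (π ∘ c) =
      stabCard (π ∘ f) * ∑ b ∈ rearrangements (π ∘ f), ψ b := by
  rw [← sum_perm_eq f (fun c => ψ (π ∘ c)), ← sum_perm_eq (π ∘ f) ψ]
  rfl

theorem mem_rearrangements_iff {f c : Fin n → ℕ} :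
    c ∈ rearrangements f ↔ ∀ v, entryCount c v = entryCount f v := by
  rw [mem_rearrangements]
  constructor
  · rintro ⟨σ, rfl⟩ v
    exact Finset.card_equiv σ fun k => by simp
  · intro h
    have e : ∀ v, Nonempty ({k // c k = v} ≃ {k // f k = v}) := by
      intro v
      rw [← Fintype.card_eq, Fintype.card_subtype, Fintype.card_subtype]
      exact h v
    exact ⟨Equiv.ofFiberEquiv fun v => (e v).some, funext fun k => Equiv.ofFiberEquiv_map _ k⟩

theorem sum_entryCount {f : Fin n → ℕ} {N : ℕ} (hN : ∀ k, f k < N) :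
    ∑ v ∈ Finset.range N, entryCount f v = n := by
  have := Finset.card_eq_sum_card_fiberwise (f := f) (s := Finset.univ) (t := Finset.range N)
    (fun k _ => Finset.mem_coe.2 (Finset.mem_range.2 (hN k)))
  rw [Finset.card_univ, Fintype.card_fin] at this
  exact this.symm

theorem entryCount_eq_zero {f : Fin n → ℕ} {v : ℕ} (h : ∀ k, f k ≠ v) : entryCount f v = 0 := by
  rw [entryCount, Finset.card_eq_zero, Finset.filter_eq_empty_iff]
  exact fun k _ => h k

end Orbits

/-! ### Counting patterns of small, almost maximal and maximal entries -/

section Patterns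

/-- Choosing a subset `R` of `T` together with `k` elements of `T \ R` that are not above `R`. -/
theorem sum_powersetCard_choose {α : Type*} [LinearOrder α] (T : Finset α) (r k : ℕ) :
    ∑ R ∈ T.powersetCard r, (((T \ R).filter fun x => ∃ y ∈ R, x < y).card).choose k =
      T.card.choose (r + k) * (r + k - 1).choose k := by
  have h1 : ∑ R ∈ T.powersetCard r, (((T \ R).filter fun x => ∃ y ∈ R, x < y).card).choose k =
      ((T.powersetCard r).sigma fun R =>
        ((T \ R).filter fun x => ∃ y ∈ R, x < y).powersetCard k).card := by
    rw [Finset.card_sigma]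
    exact Finset.sum_congr rfl fun R _ => (Finset.card_powersetCard _ _).symm
  have h2 : T.card.choose (r + k) * (r + k - 1).choose k =
      ((T.powersetCard (r + k)).sigma fun V =>
        (V.filter fun x => ∃ y ∈ V, x < y).powersetCard k).card := by
    rw [Finset.card_sigma, Finset.sum_congr rfl (g := fun _ => (r + k - 1).choose k),
      Finset.sum_const, Finset.card_powersetCard, smul_eq_mul]
    intro V hV
    rw [Finset.card_powersetCard, ← (Finset.mem_powersetCard.1 hV).2]
    congr 1
    -- The elements of `V` below another one are all but its maximum. For empty `V` the truncated `0
    -- - 1 = 0` is the correct count.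
    rcases V.eq_empty_or_nonempty with rfl | hne
    · simp
    · rw [← Finset.card_erase_of_mem (V.max'_mem hne)]
      congr 1
      ext x
      rw [Finset.mem_filter, Finset.mem_erase]
      constructor
      · rintro ⟨hx, y, hy, hxy⟩
        exact ⟨(hxy.trans_le (V.le_max' y hy)).ne, hx⟩
      · rintro ⟨hne', hx⟩
        exact ⟨hx, _, V.max'_mem hne, lt_of_le_of_ne (V.le_max' x hx) hne'⟩
  rw [h1, h2]
  -- A pair `(R, U)` corresponds to `(R ∪ U, U)`. Conversely, `U` avoids the maximum of `V`, so this
  -- maximum lies in `V \ U` and is above every element of `U`.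
  refine Finset.card_nbij' (fun q => ⟨q.1 ∪ q.2, q.2⟩) (fun q => ⟨q.1 \ q.2, q.2⟩) ?_ ?_ ?_ ?_
  · rintro ⟨R, U⟩ h
    simp only [Finset.coe_sigma, Set.mem_sigma_iff, Finset.mem_coe, Finset.mem_powersetCard] at h ⊢
    obtain ⟨⟨hRT, hR⟩, hU, hUc⟩ := h
    have hU' : ∀ x ∈ U, x ∈ T ∧ x ∉ R ∧ ∃ y ∈ R, x < y := fun x hx => by
      have := Finset.mem_filter.1 (hU hx)
      rw [Finset.mem_sdiff] at this
      exact ⟨this.1.1, this.1.2, this.2⟩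
    refine ⟨⟨Finset.union_subset hRT fun x hx => (hU' x hx).1, ?_⟩, fun x hx => ?_, hUc⟩
    · rw [Finset.card_union_of_disjoint, hR, hUc]
      exact Finset.disjoint_right.2 fun x hx => (hU' x hx).2.1
    · obtain ⟨y, hy, hxy⟩ := (hU' x hx).2.2
      exact Finset.mem_filter.2 ⟨Finset.mem_union_right _ hx, y, Finset.mem_union_left _ hy, hxy⟩
  · rintro ⟨V, U⟩ h
    simp only [Finset.coe_sigma, Set.mem_sigma_iff, Finset.mem_coe, Finset.mem_powersetCard] at h ⊢
    obtain ⟨⟨hVT, hV⟩, hU, hUc⟩ := h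
    have hUV : U ⊆ V := hU.trans (Finset.filter_subset _ _)
    refine ⟨⟨Finset.sdiff_subset.trans hVT, ?_⟩, fun x hx => ?_, hUc⟩
    · rw [Finset.card_sdiff_of_subset hUV]
      omega
    · have hne : V.Nonempty := ⟨x, hUV hx⟩
      obtain ⟨hxV, y, hy, hxy⟩ := Finset.mem_filter.1 (hU hx)
      refine Finset.mem_filter.2 ⟨Finset.mem_sdiff.2 ⟨hVT hxV, fun h => (Finset.mem_sdiff.1 h).2 hx⟩,
        V.max' hne, Finset.mem_sdiff.2 ⟨V.max'_mem hne, fun h => ?_⟩,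
        hxy.trans_le (V.le_max' y hy)⟩
      obtain ⟨-, z, hz, hlt⟩ := Finset.mem_filter.1 (hU h)
      exact absurd (V.le_max' z hz) hlt.not_ge
  · rintro ⟨R, U⟩ h
    simp only [Finset.coe_sigma, Set.mem_sigma_iff, Finset.mem_coe, Finset.mem_powersetCard] at h
    have hd : Disjoint R U := Finset.disjoint_right.2 fun x hx =>
      (Finset.mem_sdiff.1 (Finset.mem_filter.1 (h.2.1 hx)).1).2
    simp only [Finset.union_sdiff_cancel_right hd]
  · rintro ⟨V, U⟩ h
    simp only [Finset.coe_sigma, Set.mem_sigma_iff, Finset.mem_coe, Finset.mem_powersetCard] at h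
    simp only [Finset.sdiff_union_of_subset (h.2.1.trans (Finset.filter_subset _ _))]

variable {n : ℕ}

/-- The analogue of `colonSet` for patterns: `0`, `1`, `2` stand for the entries that are small,
almost maximal and maximal. -/
def patternSet (b : Fin n → ℕ) : Finset (Fin n) :=
  Finset.univ.filter fun k => b k = 0 ∨ (b k = 1 ∧ ∃ j, k < j ∧ b j = 2)

/-- The pattern with zeros at `P` and twos at `R`. -/
def patternOf (P R : Finset (Fin n)) (k : Fin n) : ℕ := if k ∈ P then 0 else if k ∈ R then 2 else 1

theorem patternOf_eq_zero {P R : Finset (Fin n)} {k : Fin n} : patternOf P R k = 0 ↔ k ∈ P := by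
  rw [patternOf]
  split_ifs <;> simp_all

theorem patternOf_eq_two {P R : Finset (Fin n)} (hR : R ⊆ Pᶜ) {k : Fin n} :
    patternOf P R k = 2 ↔ k ∈ R := by
  have := fun h => Finset.mem_compl.1 (@hR k h)
  rw [patternOf]
  split_ifs <;> simp_all

theorem patternOf_eq_one {P R : Finset (Fin n)} {k : Fin n} :
    patternOf P R k = 1 ↔ k ∉ P ∧ k ∉ R := by
  rw [patternOf]
  split_ifs <;> simp_all

theorem card_patternSet_patternOf {P R : Finset (Fin n)} (hR : R ⊆ Pᶜ) :
    (patternSet (patternOf P R)).card =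
      P.card + ((Pᶜ \ R).filter fun x => ∃ y ∈ R, x < y).card := by
  rw [← Finset.card_union_of_disjoint]
  · congr 1
    ext k
    simp only [patternSet, Finset.mem_filter, Finset.mem_univ, true_and, Finset.mem_union,
      Finset.mem_sdiff, Finset.mem_compl, patternOf_eq_zero, patternOf_eq_one,
      patternOf_eq_two hR, and_comm (a := k < _)]
  · refine Finset.disjoint_left.2 fun k hk hk' => ?_
    exact Finset.mem_compl.1 (Finset.mem_sdiff.1 (Finset.mem_filter.1 hk').1).1 hk

/-- With only the values 0, 1, 2 available, the number of ones is determined by the other two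
counts. -/
theorem entryCount_eq_of_pattern {g c : Fin n → ℕ} (hg : ∀ k, g k < 3) (hc : ∀ k, c k < 3)
    (h0 : entryCount c 0 = entryCount g 0) (h2 : entryCount c 2 = entryCount g 2) (v : ℕ) :
    entryCount c v = entryCount g v := by
  have hg' := sum_entryCount hg
  have hc' := sum_entryCount hc
  simp only [Finset.sum_range_succ, Finset.sum_range_zero] at hg' hc'
  rcases Nat.lt_or_ge v 3 with hv | hv
  · interval_cases v <;> omega
  · rw [entryCount_eq_zero (f := c) fun k => by have := hc k; omega,
      entryCount_eq_zero (f := g) fun k => by have := hg k; omega]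

theorem patternOf_lt (P R : Finset (Fin n)) (k : Fin n) : patternOf P R k < 3 := by
  rw [patternOf]
  split_ifs <;> omega

/-- A pattern is determined by the positions of its zeros and of its twos. -/
theorem sum_rearrangements_pattern {g : Fin n → ℕ} (hg : ∀ k, g k < 3) (φ : (Fin n → ℕ) → ℕ) :
    ∑ b ∈ rearrangements g, φ b =
      ∑ P ∈ Finset.univ.powersetCard (entryCount g 0),
        ∑ R ∈ Pᶜ.powersetCard (entryCount g 2), φ (patternOf P R) := by
  rw [Finset.sum_sigma']
  have hlt : ∀ b ∈ rearrangements g, ∀ k, b k < 3 := by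
    intro b hb k
    obtain ⟨σ, rfl⟩ := mem_rearrangements.1 hb
    exact hg _
  have hinv : ∀ b ∈ rearrangements g, patternOf (Finset.univ.filter fun k => b k = 0)
      (Finset.univ.filter fun k => b k = 2) = b := by
    intro b hb
    funext k
    have := hlt b hb k
    simp only [patternOf, Finset.mem_filter, Finset.mem_univ, true_and]
    split_ifs <;> omega
  refine Finset.sum_nbij' (fun b => ⟨Finset.univ.filter fun k => b k = 0,
    Finset.univ.filter fun k => b k = 2⟩) (fun q => patternOf q.1 q.2) ?_ ?_ hinv ?_ ?_
  · intro b hb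
    have h := mem_rearrangements_iff.1 hb
    simp only [Finset.mem_sigma, Finset.mem_powersetCard]
    refine ⟨⟨Finset.subset_univ _, h 0⟩, fun k hk => ?_, h 2⟩
    have := (Finset.mem_filter.1 hk).2
    rw [Finset.mem_compl, Finset.mem_filter]
    omega
  · rintro ⟨P, R⟩ h
    simp only [Finset.mem_sigma, Finset.mem_powersetCard] at h
    refine mem_rearrangements_iff.2 (entryCount_eq_of_pattern hg (patternOf_lt P R) ?_ ?_)
    · rw [← h.1.2]
      simp [entryCount, patternOf_eq_zero]
    · rw [← h.2.2]
      simp [entryCount, patternOf_eq_two h.2.1]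
  · rintro ⟨P, R⟩ h
    simp only [Finset.mem_sigma, Finset.mem_powersetCard] at h
    simp [patternOf_eq_zero, patternOf_eq_two h.2.1]
  · intro b hb
    rw [hinv b hb]

/-- For fixed zeros, `patternSet` consists of all of them and of the ones with a two to their right.
Vandermonde splits `i` between these two kinds, and `sum_powersetCard_choose` evaluates the sum over
the positions of the twos. -/
theorem sum_choose_patternSet {g : Fin n → ℕ} (hg : ∀ k, g k < 3) (i : ℕ) :
    ∑ b ∈ rearrangements g, (patternSet b).card.choose i =
      ∑ kl ∈ Finset.HasAntidiagonal.antidiagonal i, n.choose (entryCount g 0) *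
        (n - entryCount g 0).choose (entryCount g 2 + kl.1) *
        (entryCount g 2 + kl.1 - 1).choose kl.1 * (entryCount g 0).choose kl.2 := by
  rw [sum_rearrangements_pattern hg]
  have h1 : ∀ P ∈ (Finset.univ : Finset (Fin n)).powersetCard (entryCount g 0),
      ∑ R ∈ Pᶜ.powersetCard (entryCount g 2), (patternSet (patternOf P R)).card.choose i =
        ∑ kl ∈ Finset.HasAntidiagonal.antidiagonal i,
          (n - entryCount g 0).choose (entryCount g 2 + kl.1) *
          (entryCount g 2 + kl.1 - 1).choose kl.1 * (entryCount g 0).choose kl.2 := by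
    intro P hP
    have hPc := (Finset.mem_powersetCard.1 hP).2
    have h2 : ∀ R ∈ Pᶜ.powersetCard (entryCount g 2), (patternSet (patternOf P R)).card.choose i =
        ∑ kl ∈ Finset.HasAntidiagonal.antidiagonal i,
          (((Pᶜ \ R).filter fun x => ∃ y ∈ R, x < y).card).choose kl.1 *
            (entryCount g 0).choose kl.2 := by
      intro R hR
      rw [card_patternSet_patternOf (Finset.mem_powersetCard.1 hR).1, hPc, add_comm,
        Nat.add_choose_eq]
    rw [Finset.sum_congr rfl h2, Finset.sum_comm]
    refine Finset.sum_congr rfl fun kl _ => ?_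
    have h3 := sum_powersetCard_choose Pᶜ (entryCount g 2) kl.1
    rw [Finset.card_compl, Fintype.card_fin, hPc] at h3
    rw [← Finset.sum_mul, ← h3]
    congr!
  rw [Finset.sum_congr rfl h1, Finset.sum_const, Finset.card_powersetCard, Finset.card_univ,
    Fintype.card_fin, smul_eq_mul, Finset.mul_sum]
  refine Finset.sum_congr rfl fun kl _ => ?_
  ring

end Patterns

/-! ### From a partition to its pattern -/

section Partitions

variable {n : ℕ}

theorem maxPart_comp_perm (f : Fin n → ℕ) (σ : Equiv.Perm (Fin n)) :
    maxPart (f ∘ σ) = maxPart f := by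
  apply le_antisymm
  · exact Finset.sup_le fun k _ => le_maxPart f (σ k)
  · refine Finset.sup_le fun k _ => ?_
    have := le_maxPart (f ∘ σ) (σ.symm k)
    simpa using this

/-- Truncated subtraction merges all values below `M - 1` into 0 and sends `M - 1` and `M` to 1 and
2. -/
theorem colonSet_eq_patternSet {c : Fin n → ℕ} {M : ℕ} (hM : maxPart c = M) :
    colonSet c = patternSet ((fun v => v + 2 - M) ∘ c) := by
  subst hM
  refine Finset.filter_congr fun k _ => ?_
  have h1 : ∀ j, c j = maxPart c ↔ c j + 2 - maxPart c = 2 := fun j => by omega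
  have h2 : c k + 1 < maxPart c ↔ c k + 2 - maxPart c = 0 := by omega
  have h3 : c k + 1 = maxPart c ↔ c k + 2 - maxPart c = 1 := by omega
  simp only [Function.comp_apply, h1, h2, h3]

theorem lastPart_eq_maxPart {a : Fin n →₀ ℕ} (ha : Monotone a) : lastPart a = maxPart a := by
  rw [lastPart]
  split_ifs with h
  · refine le_antisymm (le_maxPart _ _) (Finset.sup_le fun k _ => ha ?_)
    rw [Fin.le_def]
    have := k.2
    simp only
    omega
  · obtain rfl : n = 0 := by omega
    simp [maxPart]

theorem mem_iff_lt_card {S : Finset (Fin n)} (hS : ∀ k ∈ S, ∀ l, l ≤ k → l ∈ S) (k : Fin n) :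
    k ∈ S ↔ (k : ℕ) < S.card := by
  constructor
  · intro hk
    have := Finset.card_le_card (show Finset.Iic k ⊆ S from fun l hl =>
      hS k hk l (Finset.mem_Iic.1 hl))
    rw [Fin.card_Iic] at this
    omega
  · intro hk
    by_contra h
    have := Finset.card_le_card (show S ⊆ Finset.Iio k from fun l hl => by
      rw [Finset.mem_Iio]
      by_contra h'
      exact h (hS l hl k (not_lt.1 h')))
    rw [Fin.card_Iio] at this
    omega

theorem lt_pNum_iff {a : Fin n →₀ ℕ} (ha : Monotone a) (k : Fin n) :
    (k : ℕ) < pNum a ↔ a k + 1 < lastPart a := by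
  rw [pNum, ← mem_iff_lt_card]
  · simp
  · intro k hk l hl
    have := ha hl
    simp only [Finset.mem_filter, Finset.mem_univ, true_and] at hk ⊢
    omega

theorem typeFactorial_eq {m : ℕ} (c : Fin m → ℕ) {N : ℕ} (hN : ∀ k, c k < N) :
    typeFactorial c = ∏ v ∈ Finset.range N, (entryCount c v).factorial := by
  rw [← stabCard_eq c N hN, stabCard_eq c ((∑ k, c k) + 1)]
  · rfl
  · intro k
    exact Nat.lt_succ_of_le (Finset.single_le_sum (fun _ _ => Nat.zero_le _) (Finset.mem_univ k))

theorem entryCount_truncation {a : Fin n →₀ ℕ} (ha : Monotone a) {v : ℕ}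
    (hv : v + 1 < lastPart a) : entryCount (truncation a) v = entryCount a v := by
  refine Finset.card_bij (fun k _ => Fin.castLE (pNum_le a) k) ?_ ?_ ?_
  · intro k hk
    exact Finset.mem_filter.2 ⟨Finset.mem_univ _, (Finset.mem_filter.1 hk).2⟩
  · intro k _ l _ h
    exact Fin.castLE_injective _ h
  · intro k hk
    have hk' : a k = v := (Finset.mem_filter.1 hk).2
    exact ⟨⟨k, (lt_pNum_iff ha k).2 (by omega)⟩,
      Finset.mem_filter.2 ⟨Finset.mem_univ _, hk'⟩, rfl⟩

/-- Passing from a partition to its pattern changes the stabilizer by the type of the truncation. -/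
theorem typeFactorial_mul_stabCard {a : Fin n →₀ ℕ} (ha : Monotone a) :
    typeFactorial (truncation a) * stabCard ((fun v => v + 2 - lastPart a) ∘ a) =
      (pNum a).factorial * stabCard a := by
  have hle : ∀ k, a k ≤ lastPart a := fun k => lastPart_eq_maxPart ha ▸ le_maxPart a k
  -- Both stabilizers are products of factorials of multiplicities. The values M - 1 and M
  -- contribute the same to each; the smaller values contribute the type factorial for `a` and `p!`
  -- for the pattern, where they have merged.
  rw [stabCard_eq _ 3 (fun k => by have := hle k; simp only [Function.comp_apply]; omega),
    stabCard_eq a (lastPart a + 1) (fun k => Nat.lt_succ_of_le (hle k))]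
  have h0 : entryCount ((fun v => v + 2 - lastPart a) ∘ a) 0 = pNum a := by
    rw [entryCount, pNum]
    congr 1
    refine Finset.filter_congr fun k _ => ?_
    simp only [Function.comp_apply]
    omega
  have h2 : entryCount ((fun v => v + 2 - lastPart a) ∘ a) 2 = entryCount a (lastPart a) := by
    rw [entryCount, entryCount]
    congr 1
    refine Finset.filter_congr fun k _ => ?_
    simp only [Function.comp_apply]
    omega
  have ht : typeFactorial (truncation a) =
      ∏ v ∈ Finset.range (lastPart a - 1), (entryCount a v).factorial := by
    rw [typeFactorial_eq _ (N := lastPart a - 1)]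
    · refine Finset.prod_congr rfl fun v hv => ?_
      rw [entryCount_truncation ha (by have := Finset.mem_range.1 hv; omega)]
    · intro k
      have := (lt_pNum_iff ha (Fin.castLE (pNum_le a) k)).1 k.2
      rw [truncation]
      omega
  rw [ht]
  simp only [Finset.prod_range_succ, Finset.prod_range_zero, one_mul]
  rw [h0, h2]
  -- If the last part is zero, there is no value one below it: the pattern has no ones, and
  -- `lastPart a - 1` is truncated to zero.
  rcases Nat.eq_zero_or_pos (lastPart a) with hz | hpos
  · have h1 : entryCount ((fun v => v + 2 - lastPart a) ∘ a) 1 = 0 :=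
      entryCount_eq_zero fun k => by simp only [Function.comp_apply]; omega
    rw [h1, hz]
    simp
  · obtain ⟨m, hm⟩ : ∃ m, lastPart a = m + 1 := ⟨lastPart a - 1, by omega⟩
    have h1 : entryCount ((fun v => v + 2 - lastPart a) ∘ a) 1 = entryCount a m := by
      rw [entryCount, entryCount]
      congr 1
      refine Finset.filter_congr fun k _ => ?_
      simp only [Function.comp_apply]
      omega
    rw [h1, hm, Nat.add_sub_cancel, Finset.prod_range_succ]
    ring

/-- The sums over rearrangements of `a` and of its pattern differ by the ratio of the stabilizer
orders, `p! / type!`; denominators are cleared to stay in the natural numbers. -/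
theorem typeFactorial_mul_sum {a : Fin n →₀ ℕ} (ha : Monotone a) (i : ℕ) :
    typeFactorial (truncation a) * ∑ c ∈ rearrangements a, (colonSet c).card.choose i =
      (pNum a).factorial * ∑ kl ∈ Finset.HasAntidiagonal.antidiagonal i, n.choose (pNum a) *
        (n - pNum a).choose (rNum a + kl.1) * (rNum a + kl.1 - 1).choose kl.1 *
          (pNum a).choose kl.2 := by
  have hle : ∀ k, a k ≤ lastPart a := fun k => lastPart_eq_maxPart ha ▸ le_maxPart a k
  let g : Fin n → ℕ := (fun v => v + 2 - lastPart a) ∘ a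
  have hg : ∀ k, g k < 3 := fun k => by
    have := hle k
    simp only [g, Function.comp_apply]
    omega
  have h0 : entryCount g 0 = pNum a := by
    rw [entryCount, pNum]
    congr 1
    refine Finset.filter_congr fun k _ => ?_
    simp only [g, Function.comp_apply]
    omega
  have h2 : entryCount g 2 = rNum a := by
    rw [entryCount, rNum]
    congr 1
    refine Finset.filter_congr fun k _ => ?_
    simp only [g, Function.comp_apply]
    omega
  have h3 := sum_rearrangements_comp a (fun v => v + 2 - lastPart a)
    (fun b => (patternSet b).card.choose i)
  have h4 : ∑ c ∈ rearrangements a, (colonSet c).card.choose i =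
      ∑ c ∈ rearrangements a, (patternSet ((fun v => v + 2 - lastPart a) ∘ c)).card.choose i := by
    refine Finset.sum_congr rfl fun c hc => ?_
    obtain ⟨σ, rfl⟩ := mem_rearrangements.1 hc
    rw [colonSet_eq_patternSet (M := lastPart a)]
    rw [maxPart_comp_perm, lastPart_eq_maxPart ha]
  rw [← h4, sum_choose_patternSet hg, h0, h2] at h3
  have h5 := typeFactorial_mul_stabCard ha
  refine Nat.eq_of_mul_eq_mul_left (stabCard_pos a) ?_
  rw [mul_left_comm, h3, ← mul_assoc, h5]
  ring

end Partitions

/-! ### Orbits of minimal generators -/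

section Generators

variable {n : ℕ} {K : Type*} [Field K] {I : Ideal (MvPolynomial (Fin n) K)}

theorem IsSymmetricIdeal.mapDomain_mem_minimalGenerators (h : IsSymmetricIdeal I) {a : Fin n →₀ ℕ}
    (ha : a ∈ minimalGenerators I) (σ : Equiv.Perm (Fin n)) :
    a.mapDomain σ ∈ minimalGenerators I := by
  refine ⟨h.mapDomain_mem ha.1 σ, fun b hb hba => ?_⟩
  have h1 := ha.2 (h.mapDomain_mem hb σ.symm) (fun k => by
    have := hba (σ k)
    rw [Finsupp.mapDomain_equiv_apply] at this ⊢
    simpa using this)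
  intro k
  have := h1 (σ.symm k)
  rw [Finsupp.mapDomain_equiv_apply] at this ⊢
  simpa using this

theorem degree_mapDomain_perm (a : Fin n →₀ ℕ) (σ : Equiv.Perm (Fin n)) :
    (a.mapDomain σ).degree = a.degree := by
  rw [Finsupp.degree_eq_sum, Finsupp.degree_eq_sum]
  simp only [Finsupp.mapDomain_equiv_apply]
  exact Equiv.sum_comp σ.symm a

/-- The nondecreasing rearrangement of an exponent. -/
noncomputable def sortExponent (a : Fin n →₀ ℕ) : Fin n →₀ ℕ :=
  a.mapDomain (Tuple.sort a).symm

theorem coe_sortExponent (a : Fin n →₀ ℕ) : ⇑(sortExponent a) = a ∘ Tuple.sort a := by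
  funext k
  rw [sortExponent, Finsupp.mapDomain_equiv_apply]
  rfl

/-- Permutations preserve minimal generators and degree, and each orbit contains exactly one
nondecreasing exponent. -/
theorem sum_generatorsOfDegree (h : IsSymmetricIdeal I) (d : ℕ) (φ : (Fin n → ℕ) → ℕ) :
    ∑ u ∈ generatorsOfDegree I d, φ u =
      ∑ a ∈ partitionGeneratorsOfSize I d, ∑ c ∈ rearrangements a, φ c := by
  classical
  rw [← Finset.sum_fiberwise_of_maps_to (g := sortExponent)
    (t := partitionGeneratorsOfSize I d)]
  · refine Finset.sum_congr rfl fun a ha => ?_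
    obtain ⟨⟨⟨hmono, -⟩, hmin⟩, hdeg⟩ := (mem_partitionGeneratorsOfSize I d a).1 ha
    refine Finset.sum_bij (fun u _ => ⇑u) ?_ ?_ ?_ ?_
    · intro u hu
      have := (Finset.mem_filter.1 hu).2
      refine mem_rearrangements.2 ⟨(Tuple.sort u).symm, ?_⟩
      rw [← this, coe_sortExponent]
      funext k
      simp
    · intro u _ v _ huv
      exact DFunLike.coe_injective huv
    · intro c hc
      obtain ⟨σ, rfl⟩ := mem_rearrangements.1 hc
      have hcoe : ⇑(a.mapDomain σ.symm) = a ∘ σ := by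
        funext k
        rw [Finsupp.mapDomain_equiv_apply]
        rfl
      refine ⟨a.mapDomain σ.symm, Finset.mem_filter.2 ⟨mem_generatorsOfDegree.2
        ⟨h.mapDomain_mem_minimalGenerators hmin _, by rw [degree_mapDomain_perm, hdeg]⟩, ?_⟩, hcoe⟩
      apply DFunLike.coe_injective
      rw [coe_sortExponent]
      have h1 := Tuple.monotone_sort (a.mapDomain σ.symm)
      rw [hcoe] at h1 ⊢
      exact Tuple.unique_monotone (f := a) (σ := σ * Tuple.sort (a ∘ σ)) (τ := 1) h1 hmono
    · intro u _
      rfl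
  · intro u hu
    obtain ⟨hmin, hdeg⟩ := mem_generatorsOfDegree.1 hu
    rw [mem_partitionGeneratorsOfSize, sortExponent, degree_mapDomain_perm]
    have h1 := h.mapDomain_mem_minimalGenerators hmin (Tuple.sort u).symm
    refine ⟨⟨⟨?_, h1.1⟩, h1⟩, hdeg⟩
    have := coe_sortExponent u
    rw [sortExponent] at this
    rw [this]
    exact Tuple.monotone_sort u

end Generators

end SymShifted

theorem corollary5p5 {n : ℕ} {K : Type*} [Field K] (I : Ideal (MvPolynomial (Fin n) K))
    (hI : SymShifted.IsSymmetricShifted I) (F : SymShifted.GradedFreeResolution I) (i d : ℕ) :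
    Module.Finite K (F.Tor i ((i : ℤ) + (d : ℤ))) ∧
    (F.betti i ((i : ℤ) + (d : ℤ)) : ℚ) =
      ∑ a ∈ SymShifted.partitionGeneratorsOfSize I d,
        ∑ kl ∈ Finset.HasAntidiagonal.antidiagonal i,
          ((SymShifted.pNum a).factorial : ℚ) /
              (SymShifted.typeFactorial (SymShifted.truncation a) : ℚ) *
            (n.choose (SymShifted.pNum a) : ℚ) *
            ((n - SymShifted.pNum a).choose (SymShifted.rNum a + kl.1) : ℚ) *
            ((SymShifted.rNum a + kl.1 - 1).choose kl.1 : ℚ) *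
            ((SymShifted.pNum a).choose kl.2 : ℚ) := by
  obtain ⟨hfin, hb⟩ := hI.betti_eq F i d
  refine ⟨hfin, ?_⟩
  rw [hb, SymShifted.sum_generatorsOfDegree hI.symmetric d
    (fun c => (SymShifted.colonSet c).card.choose i), Nat.cast_sum]
  refine Finset.sum_congr rfl fun a ha => ?_
  have hmono := ((SymShifted.mem_partitionGeneratorsOfSize I d a).1 ha).1.1.1
  have h1 := congrArg (Nat.cast (R := ℚ)) (SymShifted.typeFactorial_mul_sum hmono i)
  rw [Nat.cast_mul, Nat.cast_mul] at h1
  have h0 : (SymShifted.typeFactorial (SymShifted.truncation a) : ℚ) ≠ 0 := by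
    rw [Nat.cast_ne_zero, SymShifted.typeFactorial]
    exact Finset.prod_ne_zero_iff.2 fun v _ => Nat.factorial_ne_zero _
  -- Multiplying by the nonzero type factorial reduces the rational identity to
  -- `typeFactorial_mul_sum`.
  rw [eq_comm, ← mul_right_inj' h0, h1, Nat.cast_sum, Finset.mul_sum, Finset.mul_sum]
  refine Finset.sum_congr rfl fun kl _ => ?_
  push_cast
  field_simp
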